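/- Let $p\in\mathbb{N}$, let $Y\mid\beta\sim N_p(\beta,I_p)$ with quadratic loss $\|\hat\beta-\beta\|^2$, and consider the (possibly improper) hierarchical prior $\beta\mid\kappa\sim N_p(0,\kappa^{-1}(1-\kappa)I_p)$, where $\kappa\in(0,1)$ has density $$\pi(\kappa)=\kappa^{a-1}(1-\kappa)^{b-1}h(\kappa).$$ Here $h:(0,1]\to(0,\infty)$ is differentiable (one-sidedly at $1$), and slowly varying at $0$ with $\lim_{\kappa\to0}H(\kappa)=0$, where $H(\kappa)=\kappa h'(\kappa)/h(\kappa)$. An estimator is a measurable map $\delta:\mathbb{R}^p\to\mathbb{R}^p$; it is minimax if it minimizes $\sup_\beta E_\beta\|\delta(Y)-\beta\|^2$ among all estimators. The (generalized) Bayes estimator $\hat\beta(y)$ is the mean of the posterior of $\beta$ given $y$, i.e. of the law with density proportional to $e^{-\|y-\beta\|^2/2}\pi(\beta)$, where $$\pi(\beta)=\int_0^1 (2\pi)^{-p/2}\Bigl(\tfrac{\kappa}{1-\kappa}\Bigr)^{p/2}\exp\Bigl(-\tfrac{\kappa}{1-\kappa}\tfrac{\|\beta\|^2}{2}\Bigr)\pi(\kappa)\,d\kappa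 .$$ Suppose $-p/2\le a<p/2-2$ and, if $a=-p/2$, suppose in addition that $\int_0^1\kappa^{-1}h(\kappa)\,d\kappa<\infty$. 1. If $H$ is monotone non-increasing on $(0,1]$ with $H(1)\ge-(p/2+a+2)$, and $$\frac{p+2a+2}{3p/2+a}\le b<1,$$ then the (generalized) Bayes estimator is well defined (the marginal density $m(y)=\int (2\pi)^{-p/2}e^{-\|y-\beta\|^2/2}\pi(\beta)\,d\beta$ is positive and finite and the posterior mean exists, for every $y$) and is minimax. 2. If $H$ is monotone non-decreasing on $(0,1]$ with $H(1)<(p/2-a-2)/2$, and $$\frac{p+2a+2+2H(1)}{3p/2+a}\le b<1,$$ then the (generalized) Bayes estimator is well defined and is minimax. Moreover, in this case $\hat\beta(y)=\bigl(1-\phi(\|y\|^2)/\|y\|^2\bigr)y$ for $y\neq0$, with $$\phi(w)=w\,\frac{\int_0^1\kappa^{p/2+1}e^{-\kappa w/2}\pi(\kappa)\,d\kappa}{\int_0^1\kappa^{p/2}e^{-\kappa w/2}\pi(\kappa)\,d\kappa},$$ and $\phi$ is not monotone on $(0,\infty)$ (neither non-decreasing nor non-increasing); in particular Baranchik's condition,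 that $\phi$ be non-decreasing with $0\le\phi\le2(p-2)$, is not satisfied. -/

import Mathlib

open MeasureTheory Set Filter
open scoped ENNReal Topology

noncomputable section

namespace ShrinkagePrior

/-- The density at `y` of the normal law `N_p(β, I_p)`. -/
def normalDensity {p : ℕ} (β y : EuclideanSpace ℝ (Fin p)) : ℝ :=
  (2 * Real.pi) ^ (-((p : ℝ) / 2)) * Real.exp (-(‖y - β‖ ^ 2 / 2))

/-- The sampling model: the law of `Y ∼ N_p(β, I_p)`. -/
def normalLaw {p : ℕ} (β : EuclideanSpace ℝ (Fin p)) : Measure (EuclideanSpace ℝ (Fin p)) :=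
  volume.withDensity fun y => ENNReal.ofReal (normalDensity β y)

/-- The quadratic risk `E_β ‖δ(Y) - β‖²` of an estimator `δ`. -/
def risk {p : ℕ} (δ : EuclideanSpace ℝ (Fin p) → EuclideanSpace ℝ (Fin p))
    (β : EuclideanSpace ℝ (Fin p)) : ℝ≥0∞ :=
  ∫⁻ y, ENNReal.ofReal (‖δ y - β‖ ^ 2) ∂(normalLaw β)

/-- `δ` is a minimax estimator of the normal mean under quadratic loss: its maximal risk is the
least among all estimators. -/
def IsMinimax {p : ℕ} (δ : EuclideanSpace ℝ (Fin p) → EuclideanSpace ℝ (Fin p)) : Prop :=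
  Measurable δ ∧
    ∀ δ' : EuclideanSpace ℝ (Fin p) → EuclideanSpace ℝ (Fin p), Measurable δ' →
      (⨆ β, risk δ β) ≤ ⨆ β, risk δ' β

/-- The (possibly improper) hyperprior density
`π(κ) = κ^(a-1) (1-κ)^(b-1) h(κ)` on `(0, 1)`. -/
def priorKappa (a b : ℝ) (h : ℝ → ℝ) (κ : ℝ) : ℝ :=
  κ ^ (a - 1) * (1 - κ) ^ (b - 1) * h κ

/-- The induced (possibly improper) prior density of `β`, the mixture over `κ ∼ π` of the densities
of `N_p(0, κ⁻¹(1-κ) I_p)`. It may be infinite at `β = 0`. -/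
def priorBeta {p : ℕ} (a b : ℝ) (h : ℝ → ℝ) (β : EuclideanSpace ℝ (Fin p)) : ℝ≥0∞ :=
  ∫⁻ κ in Ioo (0 : ℝ) 1,
    ENNReal.ofReal ((2 * Real.pi) ^ (-((p : ℝ) / 2)) * (κ / (1 - κ)) ^ ((p : ℝ) / 2) *
      Real.exp (-(κ / (1 - κ) * (‖β‖ ^ 2 / 2))) * priorKappa a b h κ)

/-- The marginal density `m(y) = ∫ N_p(y | β, I_p) π(β) dβ`. -/
def marginal {p : ℕ} (a b : ℝ) (h : ℝ → ℝ) (y : EuclideanSpace ℝ (Fin p)) : ℝ≥0∞ :=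
  ∫⁻ β, ENNReal.ofReal (normalDensity β y) * priorBeta a b h β

/-- The posterior law of `β` given `y`, with density `N_p(y | β, I_p) π(β) / m(y)`. -/
def posterior {p : ℕ} (a b : ℝ) (h : ℝ → ℝ) (y : EuclideanSpace ℝ (Fin p)) :
    Measure (EuclideanSpace ℝ (Fin p)) :=
  (marginal a b h y)⁻¹ •
    volume.withDensity fun β => ENNReal.ofReal (normalDensity β y) * priorBeta a b h β

/-- The (generalized) Bayes estimator: the posterior mean `E[β | y]`. -/
def bayesEstimator (p : ℕ) (a b : ℝ) (h : ℝ → ℝ) (y : EuclideanSpace ℝ (Fin p)) :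
    EuclideanSpace ℝ (Fin p) :=
  ∫ β, β ∂(posterior a b h y)

/-- The (generalized) Bayes estimator exists: for every `y` the marginal density is positive and
finite, and the posterior law has a mean. -/
def BayesWellDefined (p : ℕ) (a b : ℝ) (h : ℝ → ℝ) : Prop :=
  ∀ y : EuclideanSpace ℝ (Fin p),
    marginal a b h y ≠ 0 ∧ marginal a b h y ≠ ∞ ∧ Integrable (fun β => β) (posterior a b h y)

/-- `H(κ) = κ h'(κ) / h(κ)` on `(0, 1]`; the derivative at `κ = 1` is the left one. -/
def H (h : ℝ → ℝ) (κ : ℝ) : ℝ :=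
  κ * derivWithin h (Ioc 0 1) κ / h κ

/-- `h` is slowly varying at `0` (from the right). -/
def SlowlyVaryingAtZero (h : ℝ → ℝ) : Prop :=
  ∀ t : ℝ, 0 < t → Tendsto (fun κ => h (t * κ) / h κ) (𝓝[>] 0) (𝓝 1)

/-- The standing assumptions on the factor `h` of the prior: it is positive and differentiable
on `(0, 1]`, and slowly varying at `0` with `κ h'(κ) / h(κ) → 0`. -/
structure IsAdmissible (h : ℝ → ℝ) : Prop where
  pos : ∀ κ ∈ Ioc (0 : ℝ) 1, 0 < h κ
  differentiableOn : DifferentiableOn ℝ h (Ioc 0 1)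
  slowlyVarying : SlowlyVaryingAtZero h
  tendsto_H : Tendsto (H h) (𝓝[>] 0) (𝓝 0)

/-- The shrinkage function `φ`, as a function of `w = ‖y‖²`. -/
def shrinkage (p : ℕ) (a b : ℝ) (h : ℝ → ℝ) (w : ℝ) : ℝ :=
  w * ((∫ κ in Ioo (0 : ℝ) 1,
          κ ^ ((p : ℝ) / 2 + 1) * Real.exp (-(κ * w / 2)) * priorKappa a b h κ) /
        ∫ κ in Ioo (0 : ℝ) 1,
          κ ^ ((p : ℝ) / 2) * Real.exp (-(κ * w / 2)) * priorKappa a b h κ)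

/-- Baranchik's sufficient condition for the minimaxity of `(1 - φ(‖y‖²) / ‖y‖²) y`. -/
def BaranchikCondition (p : ℕ) (φ : ℝ → ℝ) : Prop :=
  MonotoneOn φ (Ioi 0) ∧ ∀ w : ℝ, 0 < w → 0 ≤ φ w ∧ φ w ≤ 2 * ((p : ℝ) - 2)

end ShrinkagePrior

end

namespace ShrinkagePrior

/-! Conditionally on `κ` and `y`, the parameter is `N_p((1-κ)y, (1-κ)I_p)`, and the marginal law of
`y` given `κ` is `N_p(0, κ⁻¹I_p)`. Put `c = p/2 + a`, `s = ‖y‖²/2`, and let `M_j(s)` be the `j`-th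
moment of `κ^(c-1) (1-κ)^(b-1) h(κ) e^(-sκ)` on `(0,1)`. Mixing over `κ` gives the estimator `(1 -
r(s)) y` with `r = M₁/M₀` (`bayes_eq`), and `φ(2s) = 2 s r(s)`.

Minimaxity means risk at most `p` everywhere: normal priors of growing variance show that no
estimator has maximal risk below `p` (`ofReal_le_iSup_risk`). By Stein's identity the risk minus `p`
is the expectation of `2/M₀²` times `s(2M₂M₀ - M₁²) - p M₀M₁`, so it suffices that this is
nonpositive for all `s ≥ 0` (`risk_shrinkEstimator_le`).

This moment inequality comes from integration by parts (`mul_tiltedMoment_succ`). As `b < 1`, the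
weight may blow up at `κ = 1`; integrating `e^(-sκ)` to `e^(-sκ) - e^(-s) = e^(-sκ) u(κ)`, with `u =
1 - e^(-s(1-κ))`, removes the boundary term. The result is `s M_{j+1} = (c+j)U_j + V_j + K_j`, where
`U_j`, `V_j`, `K_j` integrate `u`, `H u` and the end term from `(1-κ)^(b-1)` against the tilted
weight. The end term is controlled by `0 ≤ K_j ≤ (1-b) s M_{j+1}`; the `U` and `V` parts at `j = 0,
1` are compared by Chebyshev's association inequality, `u` being decreasing. The two monotonicity
cases differ only in that comparison, and the lower bound on `b` is what closes the estimate
(`tiltedMoment_ineq_of_le`).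

For the shape of `φ`, the same identity at `j = 0` bounds `s r(s)` by anything above `c` for large
`s`, although when `H ≥ 0` it exceeds `c` somewhere: the deficit `c(M₀ - U₀)` is of order `e^(-s)`,
while `K₀` is at least of order `e^(-s/2)`. Hence `φ` is not non-decreasing. Since `0 < s r(s) < s`,
it is not non-increasing either. -/

/-- The density at `x` of the normal law `N_p(μ, v I_p)`. -/
noncomputable def gaussDensity {p : ℕ} (v : ℝ) (μ x : EuclideanSpace ℝ (Fin p)) : ℝ :=
  (2 * Real.pi * v) ^ (-((p : ℝ) / 2)) * Real.exp (-(‖x - μ‖ ^ 2 / (2 * v)))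

/-! ### Gaussian integrals and Stein's identity -/

section Gaussian

variable {p : ℕ} {v : ℝ} {μ : EuclideanSpace ℝ (Fin p)}

lemma normalDensity_eq_gaussDensity (β y : EuclideanSpace ℝ (Fin p)) :
    normalDensity β y = gaussDensity 1 β y := by
  simp [normalDensity, gaussDensity]

lemma gaussDensity_pos (hv : 0 < v) (x : EuclideanSpace ℝ (Fin p)) :
    0 < gaussDensity v μ x := by
  unfold gaussDensity; positivity

@[fun_prop]
lemma continuous_gaussDensity (v : ℝ) (μ : EuclideanSpace ℝ (Fin p)) :
    Continuous (gaussDensity v μ) := by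
  unfold gaussDensity; fun_prop

lemma integrable_exp_neg_mul_norm_sub_sq {b : ℝ} (hb : 0 < b) (μ : EuclideanSpace ℝ (Fin p)) :
    Integrable fun x : EuclideanSpace ℝ (Fin p) => Real.exp (-b * ‖x - μ‖ ^ 2) := by
  have h : Integrable fun x : EuclideanSpace ℝ (Fin p) => Real.exp (-b * ‖x‖ ^ 2) := by
    have h1 := (GaussianFourier.integrable_cexp_neg_mul_sq_norm_add
      (V := EuclideanSpace ℝ (Fin p)) (b := (b : ℂ)) (by simpa using hb) 0 0).norm
    refine h1.congr (Eventually.of_forall fun x => ?_)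
    simp [Complex.norm_exp, ← Complex.ofReal_pow]
  exact h.comp_sub_right μ

lemma integral_gaussDensity (hv : 0 < v) (μ : EuclideanSpace ℝ (Fin p)) :
    ∫ x, gaussDensity v μ x = 1 := by
  have h1 : ∀ x : EuclideanSpace ℝ (Fin p), gaussDensity v μ x =
      (2 * Real.pi * v) ^ (-((p : ℝ) / 2)) * Real.exp (-(1 / (2 * v)) * ‖x - μ‖ ^ 2) := by
    intro x
    unfold gaussDensity
    congr 2
    ring
  simp_rw [h1]
  rw [integral_const_mul,
    integral_sub_right_eq_self (fun x : EuclideanSpace ℝ (Fin p) =>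
      Real.exp (-(1 / (2 * v)) * ‖x‖ ^ 2)) μ,
    GaussianFourier.integral_rexp_neg_mul_sq_norm (by positivity)]
  simp only [finrank_euclideanSpace, Fintype.card_fin]
  rw [show Real.pi / (1 / (2 * v)) = 2 * Real.pi * v by field_simp,
    ← Real.rpow_add (by positivity)]
  simp

lemma integrable_mul_gaussDensity (hv : 0 < v) (μ : EuclideanSpace ℝ (Fin p))
    {g : EuclideanSpace ℝ (Fin p) → ℝ} (hg : Continuous g) {C : ℝ}
    (hC : ∀ x, |g x| ≤ C * (1 + ‖x‖ ^ 2)) : Integrable fun x => g x * gaussDensity v μ x := by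
  have hC0 : 0 ≤ C := by
    have := (abs_nonneg _).trans (hC 0)
    simpa using this
  set A := (2 * Real.pi * v) ^ (-((p : ℝ) / 2)) with hA
  have hA0 : 0 < A := by positivity
  refine ((integrable_exp_neg_mul_norm_sub_sq (b := 1 / (4 * v)) (by positivity) μ).const_mul
    (C * (1 + 2 * ‖μ‖ ^ 2 + 8 * v) * A)).mono' (by fun_prop) (Eventually.of_forall fun x => ?_)
  rw [norm_mul, Real.norm_eq_abs, Real.norm_of_nonneg (gaussDensity_pos hv x).le]
  have h1 : ‖x‖ ^ 2 ≤ 2 * ‖μ‖ ^ 2 + 2 * ‖x - μ‖ ^ 2 := by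
    have : ‖x‖ ≤ ‖x - μ‖ + ‖μ‖ := norm_le_norm_sub_add x μ
    nlinarith [sq_nonneg (‖x - μ‖ - ‖μ‖), norm_nonneg x]
  -- The density is a constant times `e^(-t) e^(-t)`; one factor absorbs the quadratic growth
  -- through `t ≤ e^t`, the other is the integrable dominating function.
  set t := ‖x - μ‖ ^ 2 / (4 * v) with ht
  have ht0 : 0 ≤ t := by positivity
  have ht1 : ‖x - μ‖ ^ 2 = 4 * v * t := by rw [ht]; field_simp
  have h2 : t ≤ Real.exp t := by linarith [Real.add_one_le_exp t]
  have h3 : 1 ≤ Real.exp t := Real.one_le_exp ht0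
  have h4 : gaussDensity v μ x = A * (Real.exp (-t) * Real.exp (-t)) := by
    rw [gaussDensity, ← Real.exp_add, ← hA, ht]
    congr 2
    field_simp
    ring
  have h5 : Real.exp (-(1 / (4 * v)) * ‖x - μ‖ ^ 2) = Real.exp (-t) := by
    rw [ht]; congr 1; ring
  rw [h4, h5]
  have h6 : 1 + ‖x‖ ^ 2 ≤ (1 + 2 * ‖μ‖ ^ 2 + 8 * v) * Real.exp t := by
    have : 0 ≤ 2 * ‖μ‖ ^ 2 := by positivity
    have : 8 * v * t ≤ 8 * v * Real.exp t := by gcongr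
    nlinarith
  have h7 : (1 + ‖x‖ ^ 2) * Real.exp (-t) ≤ 1 + 2 * ‖μ‖ ^ 2 + 8 * v := by
    have := mul_le_mul_of_nonneg_right h6 (Real.exp_pos (-t)).le
    rwa [mul_assoc, ← Real.exp_add, add_neg_cancel, Real.exp_zero, mul_one] at this
  calc |g x| * (A * (Real.exp (-t) * Real.exp (-t)))
      ≤ C * (1 + ‖x‖ ^ 2) * (A * (Real.exp (-t) * Real.exp (-t))) := by gcongr; exact hC x
    _ = C * ((1 + ‖x‖ ^ 2) * Real.exp (-t)) * A * Real.exp (-t) := by ring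
    _ ≤ C * (1 + 2 * ‖μ‖ ^ 2 + 8 * v) * A * Real.exp (-t) := by gcongr

lemma integrable_gaussDensity (hv : 0 < v) (μ : EuclideanSpace ℝ (Fin p)) :
    Integrable (gaussDensity v μ) := by
  simpa using integrable_mul_gaussDensity hv μ (g := fun _ => 1) continuous_const (C := 1)
    (fun x => by simp)

lemma norm_add_smul_single_sq (x : EuclideanSpace ℝ (Fin p)) (i : Fin p) (t : ℝ) :
    ‖x + t • EuclideanSpace.single i (1 : ℝ)‖ ^ 2 = ‖x‖ ^ 2 + 2 * t * x i + t ^ 2 := by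
  rw [norm_add_sq_real, norm_smul, inner_smul_right]
  simp [EuclideanSpace.inner_single_right]
  ring

lemma hasLineDerivAt_gaussDensity (hv : 0 < v) (μ x : EuclideanSpace ℝ (Fin p)) (i : Fin p) :
    HasLineDerivAt ℝ (gaussDensity v μ) (-((x i - μ i) / v) * gaussDensity v μ x) x
      (EuclideanSpace.single i (1 : ℝ)) := by
  unfold HasLineDerivAt
  have h1 : (fun t : ℝ => gaussDensity v μ (x + t • EuclideanSpace.single i (1 : ℝ))) =
      fun t => (2 * Real.pi * v) ^ (-((p : ℝ) / 2)) *
        Real.exp (-((‖x - μ‖ ^ 2 + 2 * t * (x i - μ i) + t ^ 2) / (2 * v))) := by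
    ext t
    rw [gaussDensity, show x + t • EuclideanSpace.single i (1 : ℝ) - μ =
      (x - μ) + t • EuclideanSpace.single i (1 : ℝ) by abel, norm_add_smul_single_sq]
    simp
  rw [h1]
  have h2 : HasDerivAt (fun t : ℝ => -((‖x - μ‖ ^ 2 + 2 * t * (x i - μ i) + t ^ 2) / (2 * v)))
      (-((x i - μ i) / v)) 0 := by
    have := (((((hasDerivAt_id (0 : ℝ)).const_mul 2).mul_const (x i - μ i)).const_add
      (‖x - μ‖ ^ 2)).add ((hasDerivAt_id (0 : ℝ)).pow 2)).div_const (2 * v) |>.neg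
    refine this.congr_deriv ?_
    simp
    field_simp
  refine (h2.exp.const_mul ((2 * Real.pi * v) ^ (-((p : ℝ) / 2)))).congr_deriv ?_
  simp [gaussDensity]
  ring

lemma abs_apply_le_norm (x : EuclideanSpace ℝ (Fin p)) (i : Fin p) : |x i| ≤ ‖x‖ := by
  simpa using PiLp.norm_apply_le x i

/-- **Stein's identity** for the law `N_p(μ, v I_p)`. -/
lemma integral_sub_mul_gaussDensity (hv : 0 < v) (μ : EuclideanSpace ℝ (Fin p)) (i : Fin p)
    {g g' : EuclideanSpace ℝ (Fin p) → ℝ} (hg : Continuous g) (hg' : Continuous g')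
    (hgg' : ∀ x, HasLineDerivAt ℝ g (g' x) x (EuclideanSpace.single i (1 : ℝ))) {C : ℝ}
    (hC : ∀ x, |g x| ≤ C * (1 + ‖x‖)) (hC' : ∀ x, |g' x| ≤ C * (1 + ‖x‖ ^ 2)) :
    ∫ x, (x i - μ i) * g x * gaussDensity v μ x = v * ∫ x, g' x * gaussDensity v μ x := by
  have hC0 : 0 ≤ C := by
    have := (abs_nonneg _).trans (hC 0)
    simpa using this
  have b1 : ∀ x : EuclideanSpace ℝ (Fin p), |g x| ≤ (2 * C) * (1 + ‖x‖ ^ 2) := fun x => by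
    refine (hC x).trans ?_
    nlinarith [sq_nonneg (‖x‖ - 1)]
  have b2 : ∀ x : EuclideanSpace ℝ (Fin p),
      |(x i - μ i) * g x| ≤ (2 * C * (1 + ‖μ‖)) * (1 + ‖x‖ ^ 2) := fun x => by
    rw [abs_mul]
    have e1 : |x i - μ i| ≤ (1 + ‖μ‖) * (1 + ‖x‖) := by
      have := abs_sub (x i) (μ i)
      have := abs_apply_le_norm x i
      have := abs_apply_le_norm μ i
      nlinarith [norm_nonneg x, norm_nonneg μ, mul_nonneg (norm_nonneg x) (norm_nonneg μ)]
    calc |x i - μ i| * |g x| ≤ ((1 + ‖μ‖) * (1 + ‖x‖)) * (C * (1 + ‖x‖)) := by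
          gcongr; exact hC x
      _ = C * (1 + ‖μ‖) * (1 + ‖x‖) ^ 2 := by ring
      _ ≤ C * (1 + ‖μ‖) * (2 * (1 + ‖x‖ ^ 2)) := by
          gcongr; nlinarith [sq_nonneg (‖x‖ - 1)]
      _ = _ := by ring
  have i1 := integrable_mul_gaussDensity hv μ hg b1
  have i2 := integrable_mul_gaussDensity hv μ
    (g := fun x => (x i - μ i) * g x) (by fun_prop) b2
  have i3 := integrable_mul_gaussDensity hv μ hg' hC'
  -- Integration by parts in direction `i`: the derivative of the density supplies the factor `-(x i
  -- - μ i) / v`.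
  have key := integral_bilinear_hasLineDerivAt_right_eq_neg_left_of_integrable
    (μ := (volume : Measure (EuclideanSpace ℝ (Fin p)))) (B := ContinuousLinearMap.mul ℝ ℝ)
    (f := gaussDensity v μ) (f' := fun x => -((x i - μ i) / v) * gaussDensity v μ x)
    (g := g) (g' := g') (v := EuclideanSpace.single i (1 : ℝ))
    (by
      refine (i2.const_mul (-(1 / v))).congr (Eventually.of_forall fun x => ?_)
      simp only [ContinuousLinearMap.mul_apply']
      ring)
    (by
      refine i3.congr (Eventually.of_forall fun x => ?_)
      simp only [ContinuousLinearMap.mul_apply']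
      ring)
    (by
      refine i1.congr (Eventually.of_forall fun x => ?_)
      simp only [ContinuousLinearMap.mul_apply']
      ring)
    (fun x _ => hasLineDerivAt_gaussDensity hv μ x i) (fun x _ => hgg' x)
  simp only [ContinuousLinearMap.mul_apply'] at key
  have e1 : ∫ x, g' x * gaussDensity v μ x = ∫ x, gaussDensity v μ x * g' x := by
    simp_rw [mul_comm]
  rw [e1, key, ← integral_neg, ← integral_const_mul]
  congr 1
  ext x
  field_simp

lemma hasLineDerivAt_apply_sub (d x : EuclideanSpace ℝ (Fin p)) (i : Fin p) :
    HasLineDerivAt ℝ (fun x : EuclideanSpace ℝ (Fin p) => x i - d i) 1 x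
      (EuclideanSpace.single i (1 : ℝ)) := by
  unfold HasLineDerivAt
  simpa using (((hasDerivAt_id (0 : ℝ)).const_add (x i)).sub_const (d i))

lemma integral_apply_sub_mul_gaussDensity (hv : 0 < v) (μ : EuclideanSpace ℝ (Fin p))
    (i : Fin p) : ∫ x, (x i - μ i) * gaussDensity v μ x = 0 := by
  have := integral_sub_mul_gaussDensity hv μ i (g := fun _ => 1) (g' := fun _ => 0)
    continuous_const continuous_const
    (fun x => by unfold HasLineDerivAt; exact hasDerivAt_const _ _) (C := 1)
    (fun x => by simp) (fun x => by simp; positivity)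
  simpa using this

lemma integral_apply_sub_sq_mul_gaussDensity (hv : 0 < v) (μ : EuclideanSpace ℝ (Fin p))
    (i : Fin p) : ∫ x, (x i - μ i) ^ 2 * gaussDensity v μ x = v := by
  have := integral_sub_mul_gaussDensity hv μ i (g := fun x => x i - μ i) (g' := fun _ => 1)
    (by fun_prop) continuous_const (fun x => hasLineDerivAt_apply_sub μ x i) (C := 1 + ‖μ‖)
    (fun x => by
      have := abs_sub (x i) (μ i)
      have := abs_apply_le_norm x i
      have := abs_apply_le_norm μ i
      nlinarith [norm_nonneg x, norm_nonneg μ, mul_nonneg (norm_nonneg x) (norm_nonneg μ)])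
    (fun x => by
      rw [abs_one]
      nlinarith [norm_nonneg μ, sq_nonneg ‖x‖, mul_nonneg (norm_nonneg μ) (sq_nonneg ‖x‖)])
  simpa [integral_gaussDensity hv, sq] using this

lemma abs_norm_sub_sq_le (d x : EuclideanSpace ℝ (Fin p)) :
    |‖x - d‖ ^ 2| ≤ (2 * (1 + ‖d‖ ^ 2)) * (1 + ‖x‖ ^ 2) := by
  rw [abs_of_nonneg (sq_nonneg _)]
  have := norm_sub_le x d
  nlinarith [sq_nonneg (‖x‖ - ‖d‖), norm_nonneg (x - d), mul_nonneg (sq_nonneg ‖x‖)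
    (sq_nonneg ‖d‖)]

lemma integrable_norm_sub_sq_mul_gaussDensity (hv : 0 < v) (μ d : EuclideanSpace ℝ (Fin p)) :
    Integrable fun x => ‖x - d‖ ^ 2 * gaussDensity v μ x :=
  integrable_mul_gaussDensity hv μ (by fun_prop) (abs_norm_sub_sq_le d)

lemma integrable_apply_sub_sq_mul_gaussDensity (hv : 0 < v) (μ d : EuclideanSpace ℝ (Fin p))
    (i : Fin p) : Integrable fun x => (x i - d i) ^ 2 * gaussDensity v μ x :=
  integrable_mul_gaussDensity hv μ (by fun_prop) fun x => by
    refine le_trans ?_ (abs_norm_sub_sq_le d x)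
    rw [abs_of_nonneg (sq_nonneg _), abs_of_nonneg (sq_nonneg _), ← sq_abs]
    gcongr
    exact abs_apply_le_norm (x - d) i

lemma integrable_apply_sub_mul_gaussDensity (hv : 0 < v) (μ d : EuclideanSpace ℝ (Fin p))
    (i : Fin p) : Integrable fun x => (x i - d i) * gaussDensity v μ x :=
  integrable_mul_gaussDensity hv μ (C := 2 * (1 + ‖d‖ ^ 2) + 1) (by fun_prop) fun x => by
    have h1 := abs_norm_sub_sq_le d x
    rw [abs_of_nonneg (sq_nonneg _)] at h1
    have h2 : |x i - d i| ≤ ‖x - d‖ := abs_apply_le_norm (x - d) i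
    nlinarith [sq_nonneg (‖x - d‖ - 1), sq_nonneg ‖x‖]

lemma integral_norm_sub_sq_mul_gaussDensity (hv : 0 < v) (μ d : EuclideanSpace ℝ (Fin p)) :
    ∫ x, ‖x - d‖ ^ 2 * gaussDensity v μ x = p * v + ‖μ - d‖ ^ 2 := by
  have h1 : ∀ i : Fin p, ∫ x, (x i - d i) ^ 2 * gaussDensity v μ x = v + (μ i - d i) ^ 2 := by
    intro i
    have e : ∀ x : EuclideanSpace ℝ (Fin p), (x i - d i) ^ 2 * gaussDensity v μ x =
        (x i - μ i) ^ 2 * gaussDensity v μ x +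
          (2 * (μ i - d i) * ((x i - μ i) * gaussDensity v μ x) +
            (μ i - d i) ^ 2 * gaussDensity v μ x) := fun x => by ring
    have i1 := integrable_apply_sub_sq_mul_gaussDensity hv μ μ i
    have i2 := (integrable_apply_sub_mul_gaussDensity hv μ μ i).const_mul (2 * (μ i - d i))
    have i3 := (integrable_gaussDensity hv μ).const_mul ((μ i - d i) ^ 2)
    have i4 : Integrable fun x => 2 * (μ i - d i) * ((x i - μ i) * gaussDensity v μ x) +
        (μ i - d i) ^ 2 * gaussDensity v μ x := i2.add i3
    simp_rw [e]
    rw [integral_add i1 i4, integral_add i2 i3, integral_const_mul, integral_const_mul,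
      integral_gaussDensity hv, integral_apply_sub_mul_gaussDensity hv,
      integral_apply_sub_sq_mul_gaussDensity hv]
    ring
  have h2 : ∀ x : EuclideanSpace ℝ (Fin p), ‖x - d‖ ^ 2 * gaussDensity v μ x =
      ∑ i, (x i - d i) ^ 2 * gaussDensity v μ x := fun x => by
    rw [EuclideanSpace.real_norm_sq_eq, Finset.sum_mul]
    rfl
  simp_rw [h2]
  rw [integral_finsetSum _ fun i _ => integrable_apply_sub_sq_mul_gaussDensity hv μ d i]
  simp_rw [h1]
  rw [Finset.sum_add_distrib, EuclideanSpace.real_norm_sq_eq]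
  simp

end Gaussian

/-! ### Moments of tilted weights and Chebyshev's inequality -/

/-- The tilted weight `κ^j e^(-sκ) f(κ)`. -/
noncomputable def tilted (f : ℝ → ℝ) (j : ℕ) (s κ : ℝ) : ℝ := κ ^ j * Real.exp (-(s * κ)) * f κ

/-- The moments `∫₀¹ κ^j e^(-sκ) f(κ) dκ` of an exponentially tilted weight on `(0, 1)`. -/
noncomputable def tiltedMoment (f : ℝ → ℝ) (j : ℕ) (s : ℝ) : ℝ :=
  ∫ κ in Ioo (0 : ℝ) 1, tilted f j s κ

section Tilted

variable {f : ℝ → ℝ}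

lemma integrableOn_bdd_mul (hf : IntegrableOn f (Ioo 0 1)) {g : ℝ → ℝ} {B : ℝ}
    (hg : AEStronglyMeasurable g (volume.restrict (Ioo 0 1)))
    (hB : ∀ κ ∈ Ioo (0 : ℝ) 1, |g κ| ≤ B) : IntegrableOn (fun κ => g κ * f κ) (Ioo 0 1) :=
  Integrable.bdd_mul (c := B) hf hg
    ((ae_restrict_iff' measurableSet_Ioo).2 (Eventually.of_forall hB))

lemma pow_mul_exp_le {κ : ℝ} (hκ : κ ∈ Ioo (0 : ℝ) 1) (j : ℕ) (s : ℝ) :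
    κ ^ j * Real.exp (-(s * κ)) ≤ Real.exp |s| := by
  have h1 : κ ^ j ≤ 1 := pow_le_one₀ hκ.1.le hκ.2.le
  have h2 : -(s * κ) ≤ |s| := by
    have := neg_abs_le s
    have := abs_nonneg s
    nlinarith [hκ.1, hκ.2, mul_nonneg this (sub_nonneg.2 hκ.2.le),
      mul_nonneg hκ.1.le (by linarith : 0 ≤ s + |s|)]
  calc κ ^ j * Real.exp (-(s * κ)) ≤ 1 * Real.exp |s| := by gcongr
    _ = _ := one_mul _

lemma integrableOn_tilted (hf : IntegrableOn f (Ioo 0 1)) (j : ℕ) (s : ℝ) :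
    IntegrableOn (tilted f j s) (Ioo 0 1) :=
  integrableOn_bdd_mul hf (B := Real.exp |s|) (by fun_prop) fun κ hκ => by
    rw [abs_of_nonneg (mul_nonneg (pow_nonneg hκ.1.le _) (Real.exp_pos _).le)]
    exact pow_mul_exp_le hκ j s

lemma setIntegral_Ioo_pos {g : ℝ → ℝ} {u v : ℝ} (huv : u < v) (hg : IntegrableOn g (Ioo u v))
    (hpos : ∀ κ ∈ Ioo u v, 0 < g κ) : 0 < ∫ κ in Ioo u v, g κ := by
  rw [setIntegral_pos_iff_support_of_nonneg_ae _ hg]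
  · have : Function.support g ∩ Ioo u v = Ioo u v :=
      inter_eq_right.2 fun κ hκ => (hpos κ hκ).ne'
    simp [this, huv]
  · exact (ae_restrict_iff' measurableSet_Ioo).2 (Eventually.of_forall fun κ hκ => (hpos κ hκ).le)

lemma tiltedMoment_pos (hf : IntegrableOn f (Ioo 0 1)) (hpos : ∀ κ ∈ Ioo (0 : ℝ) 1, 0 < f κ)
    (j : ℕ) (s : ℝ) : 0 < tiltedMoment f j s :=
  setIntegral_Ioo_pos one_pos (integrableOn_tilted hf j s) fun κ hκ =>
    mul_pos (mul_pos (pow_pos hκ.1 _) (Real.exp_pos _)) (hpos κ hκ)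

lemma tiltedMoment_succ_lt (hf : IntegrableOn f (Ioo 0 1)) (hpos : ∀ κ ∈ Ioo (0 : ℝ) 1, 0 < f κ)
    (j : ℕ) (s : ℝ) : tiltedMoment f (j + 1) s < tiltedMoment f j s := by
  rw [← sub_pos]
  unfold tiltedMoment
  rw [← integral_sub (integrableOn_tilted hf j s) (integrableOn_tilted hf (j + 1) s)]
  refine setIntegral_Ioo_pos one_pos
    ((integrableOn_tilted hf j s).sub (integrableOn_tilted hf (j + 1) s)) fun κ hκ => ?_
  have : tilted f j s κ - tilted f (j + 1) s κ =
    κ ^ j * Real.exp (-(s * κ)) * f κ * (1 - κ) := by unfold tilted; ring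
  rw [this]
  exact mul_pos (mul_pos (mul_pos (pow_pos hκ.1 _) (Real.exp_pos _)) (hpos κ hκ))
    (sub_pos.2 hκ.2)

/-- Differentiation under the integral: on the unit ball around `s` the derivative is dominated by
`e^(|s|+1) |f|`. -/
lemma hasDerivAt_tiltedMoment (hf : IntegrableOn f (Ioo 0 1)) (j : ℕ) (s : ℝ) :
    HasDerivAt (tiltedMoment f j) (-tiltedMoment f (j + 1) s) s := by
  have key := hasDerivAt_integral_of_dominated_loc_of_deriv_le
    (μ := volume.restrict (Ioo (0 : ℝ) 1)) (s := Metric.ball s 1) (x₀ := s)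
    (F := fun t κ => tilted f j t κ)
    (F' := fun t κ => -tilted f (j + 1) t κ)
    (bound := fun κ => Real.exp (|s| + 1) * |f κ|)
    (Metric.ball_mem_nhds s one_pos)
    (Eventually.of_forall fun t => (integrableOn_tilted hf j t).aestronglyMeasurable)
    (integrableOn_tilted hf j s) (integrableOn_tilted hf (j + 1) s).neg.aestronglyMeasurable
    ((ae_restrict_iff' measurableSet_Ioo).2 (Eventually.of_forall fun κ hκ t ht => ?_))
    (Integrable.const_mul (Integrable.abs hf) _)
    (Eventually.of_forall fun κ t _ => ?_)
  · have := key.2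
    rw [integral_neg] at this
    exact this
  · rw [tilted, norm_neg, norm_mul, Real.norm_eq_abs, Real.norm_eq_abs,
      abs_of_nonneg (mul_nonneg (pow_nonneg hκ.1.le _) (Real.exp_pos _).le)]
    gcongr
    refine (pow_mul_exp_le hκ (j + 1) t).trans (Real.exp_le_exp.2 ?_)
    rw [Metric.mem_ball, Real.dist_eq] at ht
    have := abs_sub_abs_le_abs_sub t s
    linarith
  · have h1 : HasDerivAt (fun t : ℝ => -(t * κ)) (-κ) t := 
      ((hasDerivAt_id t).mul_const κ).neg.congr_deriv (by simp)
    refine ((h1.exp.const_mul (κ ^ j)).mul_const (f κ)).congr_deriv ?_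
    unfold tilted
    ring

/-- **Chebyshev's association inequality**: multiplying a weight on `(0, 1)` by `κ` decreases the
weighted mean of an antitone function. -/
lemma integral_mul_antitoneOn_le {W g : ℝ → ℝ} {B : ℝ} (hW : IntegrableOn W (Ioo 0 1))
    (hpos : ∀ κ ∈ Ioo (0 : ℝ) 1, 0 < W κ) (hg : AntitoneOn g (Ioo 0 1))
    (hB : ∀ κ ∈ Ioo (0 : ℝ) 1, |g κ| ≤ B) :
    (∫ κ in Ioo (0 : ℝ) 1, g κ * (κ * W κ)) * (∫ κ in Ioo (0 : ℝ) 1, W κ) ≤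
      (∫ κ in Ioo (0 : ℝ) 1, g κ * W κ) * ∫ κ in Ioo (0 : ℝ) 1, κ * W κ := by
  have hgm : AEStronglyMeasurable g (volume.restrict (Ioo 0 1)) :=
    (aemeasurable_restrict_of_antitoneOn measurableSet_Ioo hg).aestronglyMeasurable
  have i1 : IntegrableOn (fun κ => κ * W κ) (Ioo 0 1) :=
    integrableOn_bdd_mul hW (B := 1) (by fun_prop) fun κ hκ => by
      rw [abs_of_pos hκ.1]; exact hκ.2.le
  have i2 : IntegrableOn (fun κ => g κ * W κ) (Ioo 0 1) := integrableOn_bdd_mul hW hgm hB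
  have i3 : IntegrableOn (fun κ => g κ * (κ * W κ)) (Ioo 0 1) := integrableOn_bdd_mul i1 hgm hB
  set m0 := ∫ κ in Ioo (0 : ℝ) 1, W κ with hm0
  set m1 := ∫ κ in Ioo (0 : ℝ) 1, κ * W κ with hm1
  have p0 : 0 < m0 := setIntegral_Ioo_pos one_pos hW hpos
  have p1 : 0 < m1 := setIntegral_Ioo_pos one_pos i1 fun κ hκ => mul_pos hκ.1 (hpos κ hκ)
  have p2 : m1 < m0 := by
    rw [← sub_pos, hm0, hm1, ← integral_sub hW i1]
    refine setIntegral_Ioo_pos one_pos (hW.sub i1) fun κ hκ => ?_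
    nlinarith [hpos κ hκ, hκ.2]
  -- `q` is the `W`-mean of `κ`. As `g` is antitone, `(q - κ)(g κ - g q) ≥ 0`, and the terms with
  -- the constant `g q` integrate to zero.
  set q := m1 / m0 with hq
  have hq' : m1 = q * m0 := by rw [hq]; field_simp
  have q1 : q ∈ Ioo (0 : ℝ) 1 := ⟨by positivity, by rwa [hq, div_lt_one p0]⟩
  have key : 0 ≤ ∫ κ in Ioo (0 : ℝ) 1,
      (q * (g κ * W κ) - g κ * (κ * W κ)) + g q * (κ * W κ - q * W κ) := by
    refine setIntegral_nonneg measurableSet_Ioo fun κ hκ => ?_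
    have e : (q * (g κ * W κ) - g κ * (κ * W κ)) + g q * (κ * W κ - q * W κ) =
        ((q - κ) * (g κ - g q)) * W κ := by ring
    rw [e]
    refine mul_nonneg ?_ (hpos κ hκ).le
    rcases le_total κ q with h | h
    · exact mul_nonneg (sub_nonneg.2 h) (sub_nonneg.2 (hg hκ q1 h))
    · exact mul_nonneg_of_nonpos_of_nonpos (sub_nonpos.2 h) (sub_nonpos.2 (hg q1 hκ h))
  have j1 : IntegrableOn (fun κ => q * (g κ * W κ) - g κ * (κ * W κ)) (Ioo 0 1) :=
    (i2.const_mul q).sub i3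
  have j2 : IntegrableOn (fun κ => κ * W κ - q * W κ) (Ioo 0 1) := i1.sub (hW.const_mul q)
  rw [integral_add j1 (j2.const_mul _), integral_sub (i2.const_mul q) i3, integral_const_mul,
    integral_const_mul, integral_sub i1 (hW.const_mul q), integral_const_mul, ← hm0, ← hm1, hq',
    sub_self, mul_zero, add_zero] at key
  rw [hq']
  nlinarith

end Tilted

/-! ### Integration by parts on `(0, 1)` -/

/-- The weight `κ^(c-1) (1-κ)^(b-1) h(κ)`. -/
noncomputable def betaWeight (c b : ℝ) (h : ℝ → ℝ) (κ : ℝ) : ℝ :=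
  κ ^ (c - 1) * (1 - κ) ^ (b - 1) * h κ

/-- The regularity of `κ^(c-1) (1-κ)^(b-1) h(κ)` needed to integrate by parts on `(0, 1)`. -/
structure IsRegularWeight (c b : ℝ) (h : ℝ → ℝ) : Prop where
  nonneg : 0 ≤ c
  pos_b : 0 < b
  b_lt_one : b < 1
  pos : ∀ κ ∈ Ioo (0 : ℝ) 1, 0 < h κ
  hasDerivAt : ∀ κ ∈ Ioo (0 : ℝ) 1, HasDerivAt h (H h κ * h κ / κ) κ
  integrableOn : IntegrableOn (betaWeight c b h) (Ioo 0 1)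
  tendsto_zero : Tendsto (fun κ => κ ^ c * h κ) (𝓝[>] 0) (𝓝 0)
  tendsto_one : Tendsto h (𝓝[<] 1) (𝓝 (h 1))
  measurable_H : AEStronglyMeasurable (H h) (volume.restrict (Ioo 0 1))
  bounded_H : ∃ B, ∀ κ ∈ Ioo (0 : ℝ) 1, |H h κ| ≤ B

/-- The factor `1 - e^(-s(1-κ))` that makes boundary terms at `κ = 1` vanish. -/
noncomputable def damping (s κ : ℝ) : ℝ := 1 - Real.exp (-(s * (1 - κ)))

@[fun_prop]
lemma continuous_damping (s : ℝ) : Continuous (damping s) := by unfold damping; fun_prop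

section Damping

variable {s κ : ℝ}

lemma damping_nonneg (hs : 0 ≤ s) (hκ : κ ∈ Ioo (0 : ℝ) 1) : 0 ≤ damping s κ := by
  have : 0 ≤ s * (1 - κ) := mul_nonneg hs (sub_nonneg.2 hκ.2.le)
  rw [damping, sub_nonneg]
  exact Real.exp_le_one_iff.2 (by linarith)

lemma damping_le_one : damping s κ ≤ 1 := by
  unfold damping; linarith [Real.exp_pos (-(s * (1 - κ)))]

lemma damping_le : damping s κ ≤ s * (1 - κ) := by
  unfold damping; linarith [Real.add_one_le_exp (-(s * (1 - κ)))]

lemma damping_antitone (hs : 0 ≤ s) : Antitone (damping s) := by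
  intro x y hxy
  unfold damping
  gcongr

lemma abs_damping_le (hs : 0 ≤ s) (hκ : κ ∈ Ioo (0 : ℝ) 1) : |damping s κ| ≤ 1 := by
  rw [abs_of_nonneg (damping_nonneg hs hκ)]; exact damping_le_one

end Damping

/-- The contribution `(1-b) κ/(1-κ) (1 - e^(-s(1-κ)))` of the factor `(1-κ)^(b-1)` to the
integration by parts. -/
noncomputable def endTerm (b s κ : ℝ) : ℝ := (1 - b) * (κ / (1 - κ)) * damping s κ

section EndTerm

variable {b s κ : ℝ}

lemma endTerm_nonneg (hb : b < 1) (hs : 0 ≤ s) (hκ : κ ∈ Ioo (0 : ℝ) 1) : 0 ≤ endTerm b s κ :=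
  mul_nonneg (mul_nonneg (by linarith) (div_nonneg hκ.1.le (by linarith [hκ.2])))
    (damping_nonneg hs hκ)

/-- The damping is at most `s(1-κ)`, which cancels the pole of `κ/(1-κ)`; the factor `κ` left over
raises the moment index by one. -/
lemma endTerm_le (hb : b < 1) (hκ : κ ∈ Ioo (0 : ℝ) 1) : endTerm b s κ ≤ (1 - b) * s * κ := by
  have h1 : 0 < 1 - κ := sub_pos.2 hκ.2
  calc endTerm b s κ ≤ (1 - b) * (κ / (1 - κ)) * (s * (1 - κ)) := by
        unfold endTerm
        exact mul_le_mul_of_nonneg_left damping_le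
          (mul_nonneg (by linarith) (div_nonneg hκ.1.le h1.le))
    _ = (1 - b) * s * κ := by field_simp

lemma abs_endTerm_le (hb : b < 1) (hs : 0 ≤ s) (hκ : κ ∈ Ioo (0 : ℝ) 1) :
    |endTerm b s κ| ≤ (1 - b) * s := by
  rw [abs_of_nonneg (endTerm_nonneg hb hs hκ)]
  refine (endTerm_le hb hκ).trans ?_
  exact mul_le_of_le_one_right (mul_nonneg (by linarith) hs) hκ.2.le

lemma aestronglyMeasurable_endTerm :
    AEStronglyMeasurable (endTerm b s) (volume.restrict (Ioo 0 1)) := by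
  have : Measurable (endTerm b s) := by unfold endTerm; fun_prop
  exact this.aestronglyMeasurable

end EndTerm

namespace IsRegularWeight

variable {c b : ℝ} {h : ℝ → ℝ} (w : IsRegularWeight c b h)
include w

lemma betaWeight_pos : ∀ κ ∈ Ioo (0 : ℝ) 1, 0 < betaWeight c b h κ := fun κ hκ =>
  mul_pos (mul_pos (Real.rpow_pos_of_pos hκ.1 _) (Real.rpow_pos_of_pos (sub_pos.2 hκ.2) _))
    (w.pos κ hκ)

lemma integrableOn_tilted (j : ℕ) (s : ℝ) :
    IntegrableOn (tilted (betaWeight c b h) j s) (Ioo 0 1) :=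
  ShrinkagePrior.integrableOn_tilted w.integrableOn j s

lemma tilted_pos (j : ℕ) (s : ℝ) : ∀ κ ∈ Ioo (0 : ℝ) 1, 0 < tilted (betaWeight c b h) j s κ :=
  fun κ hκ => mul_pos (mul_pos (pow_pos hκ.1 _) (Real.exp_pos _)) (w.betaWeight_pos κ hκ)

lemma integrableOn_damping_mul {s : ℝ} (hs : 0 ≤ s) (j : ℕ) :
    IntegrableOn (fun κ => damping s κ * tilted (betaWeight c b h) j s κ) (Ioo 0 1) :=
  integrableOn_bdd_mul (w.integrableOn_tilted j s) (by fun_prop)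
    fun _ hκ => abs_damping_le hs hκ

lemma integrableOn_H_mul {s : ℝ} (hs : 0 ≤ s) (j : ℕ) :
    IntegrableOn (fun κ => H h κ * damping s κ * tilted (betaWeight c b h) j s κ) (Ioo 0 1) := by
  obtain ⟨B, hB⟩ := w.bounded_H
  refine integrableOn_bdd_mul (B := B) (w.integrableOn_tilted j s)
    (w.measurable_H.mul (by fun_prop)) fun κ hκ => ?_
  rw [abs_mul]
  calc |H h κ| * |damping s κ| ≤ |H h κ| * 1 := by gcongr; exact abs_damping_le hs hκ
    _ ≤ B := by rw [mul_one]; exact hB κ hκ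

lemma integrableOn_endTerm_mul {s : ℝ} (hs : 0 ≤ s) (j : ℕ) :
    IntegrableOn (fun κ => endTerm b s κ * tilted (betaWeight c b h) j s κ) (Ioo 0 1) :=
  integrableOn_bdd_mul (w.integrableOn_tilted j s) aestronglyMeasurable_endTerm
    fun _ hκ => abs_endTerm_le w.b_lt_one hs hκ

lemma hasDerivAt_boundary (j : ℕ) (s : ℝ) {κ : ℝ} (hκ : κ ∈ Ioo (0 : ℝ) 1) :
    HasDerivAt (fun κ => κ ^ j * (κ ^ c * h κ) * ((1 - κ) ^ (b - 1) *
        (Real.exp (-(s * κ)) * damping s κ)))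
      ((c + j) * (damping s κ * tilted (betaWeight c b h) j s κ) +
        H h κ * damping s κ * tilted (betaWeight c b h) j s κ +
        endTerm b s κ * tilted (betaWeight c b h) j s κ -
        s * tilted (betaWeight c b h) (j + 1) s κ) κ := by
  have hκ0 : κ ≠ 0 := hκ.1.ne'
  have hκ1 : 0 < 1 - κ := sub_pos.2 hκ.2
  have d1 : HasDerivAt (fun κ : ℝ => κ ^ j) (j * κ ^ j / κ) κ := by
    refine (hasDerivAt_pow j κ).congr_deriv ?_
    rcases j with _ | j
    · simp
    · simp only [Nat.add_sub_cancel, pow_succ]; field_simp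
  have d2 : HasDerivAt (fun κ : ℝ => κ ^ c) (c * κ ^ (c - 1)) κ :=
    Real.hasDerivAt_rpow_const (Or.inl hκ0)
  have d3 : HasDerivAt (fun κ : ℝ => 1 - κ) (-1) κ := by
    simpa using (hasDerivAt_id κ).const_sub 1
  have d4 : HasDerivAt (fun κ : ℝ => (1 - κ) ^ (b - 1))
      ((1 - b) * ((1 - κ) ^ (b - 1) / (1 - κ))) κ := by
    refine (d3.rpow_const (p := b - 1) (Or.inl hκ1.ne')).congr_deriv ?_
    rw [Real.rpow_sub_one hκ1.ne']
    ring
  have d5 : HasDerivAt (fun κ => Real.exp (-(s * κ)) * damping s κ)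
      (-s * Real.exp (-(s * κ))) κ := by
    -- This is the exponential shifted by a constant so as to vanish at `κ = 1`; its derivative is
    -- undamped, which produces the plain moment `M_{j+1}`.
    have e : (fun κ => Real.exp (-(s * κ)) * damping s κ) =
        fun κ => Real.exp (-(s * κ)) - Real.exp (-s) := by
      ext x
      rw [damping, mul_sub, mul_one, ← Real.exp_add]
      congr 2
      ring
    rw [e]
    have h1 : HasDerivAt (fun κ : ℝ => -(s * κ)) (-s) κ :=
      ((hasDerivAt_id κ).const_mul s).neg.congr_deriv (by simp)
    refine (h1.exp.sub_const _).congr_deriv ?_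
    ring
  have hc1 : κ ^ c = κ ^ (c - 1) * κ := by
    rw [Real.rpow_sub_one hκ0]; field_simp
  refine ((d1.mul (d2.mul (w.hasDerivAt κ hκ))).mul (d4.mul d5)).congr_deriv ?_
  simp only [tilted, betaWeight, endTerm, Pi.mul_apply, hc1]
  field_simp
  ring

lemma tendsto_boundary_zero (j : ℕ) (s : ℝ) :
    Tendsto (fun κ => κ ^ j * (κ ^ c * h κ) * ((1 - κ) ^ (b - 1) *
        (Real.exp (-(s * κ)) * damping s κ))) (𝓝[>] 0) (𝓝 0) := by
  have t1 : Tendsto (fun κ : ℝ => κ ^ j) (𝓝[>] 0) (𝓝 (0 ^ j)) :=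
    ((continuous_pow j).tendsto 0).mono_left nhdsWithin_le_nhds
  have t2 : Tendsto (fun κ : ℝ => (1 - κ) ^ (b - 1) * (Real.exp (-(s * κ)) * damping s κ))
      (𝓝[>] 0) (𝓝 ((1 - 0) ^ (b - 1) * (Real.exp (-(s * 0)) * damping s 0))) := by
    refine Tendsto.mono_left (ContinuousAt.tendsto ?_) nhdsWithin_le_nhds
    refine ContinuousAt.mul ?_ (by fun_prop)
    exact ContinuousAt.rpow_const (by fun_prop) (Or.inl (by norm_num))
  simpa using (t1.mul w.tendsto_zero).mul t2

/-- Damping trades the singular `(1-κ)^(b-1)` for a multiple of `(1-κ)^b`, which vanishes at `1`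
because `b > 0`. -/
lemma tendsto_boundary_one (j : ℕ) {s : ℝ} (hs : 0 ≤ s) :
    Tendsto (fun κ => κ ^ j * (κ ^ c * h κ) * ((1 - κ) ^ (b - 1) *
        (Real.exp (-(s * κ)) * damping s κ))) (𝓝[<] 1) (𝓝 0) := by
  have t1 : Tendsto (fun κ : ℝ => κ ^ j * (κ ^ c * h κ)) (𝓝[<] 1) (𝓝 (1 ^ j * (1 ^ c * h 1))) :=
    (((continuous_pow j).tendsto 1).mono_left nhdsWithin_le_nhds).mul
      (((Real.continuousAt_rpow_const 1 c (Or.inl one_ne_zero)).tendsto.mono_left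
        nhdsWithin_le_nhds).mul w.tendsto_one)
  have t2 : Tendsto (fun κ : ℝ => (1 - κ) ^ (b - 1) * (Real.exp (-(s * κ)) * damping s κ))
      (𝓝[<] 1) (𝓝 0) := by
    have t3 : Tendsto (fun κ : ℝ => s * (1 - κ) ^ b) (𝓝[<] 1) (𝓝 0) := by
      have : ContinuousAt (fun κ : ℝ => s * (1 - κ) ^ b) 1 :=
        ContinuousAt.mul continuousAt_const
          (ContinuousAt.rpow_const (by fun_prop) (Or.inr w.pos_b.le))
      simpa [Real.zero_rpow w.pos_b.ne'] using this.tendsto.mono_left nhdsWithin_le_nhds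
    have hev : ∀ᶠ κ : ℝ in 𝓝[<] 1, κ ∈ Ioo (0 : ℝ) 1 := Ioo_mem_nhdsLT zero_lt_one
    refine tendsto_of_tendsto_of_tendsto_of_le_of_le' tendsto_const_nhds t3 ?_ ?_
    · filter_upwards [hev] with κ hκ
      exact mul_nonneg (Real.rpow_nonneg (sub_nonneg.2 hκ.2.le) _)
        (mul_nonneg (Real.exp_pos _).le (damping_nonneg hs hκ))
    · filter_upwards [hev] with κ hκ
      have h1 : 0 < 1 - κ := sub_pos.2 hκ.2
      have h2 : Real.exp (-(s * κ)) ≤ 1 :=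
        Real.exp_le_one_iff.2 (by linarith [mul_nonneg hs hκ.1.le])
      calc (1 - κ) ^ (b - 1) * (Real.exp (-(s * κ)) * damping s κ)
          ≤ (1 - κ) ^ (b - 1) * (1 * (s * (1 - κ))) := by
            gcongr
            · exact damping_nonneg hs hκ
            · exact damping_le
        _ = s * (1 - κ) ^ b := by rw [Real.rpow_sub_one h1.ne']; field_simp
  simpa using t1.mul t2

/-- Integration by parts for the moments of the tilted weight. -/
lemma mul_tiltedMoment_succ (j : ℕ) {s : ℝ} (hs : 0 ≤ s) :
    s * tiltedMoment (betaWeight c b h) (j + 1) s =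
      (c + j) * (∫ κ in Ioo (0 : ℝ) 1, damping s κ * tilted (betaWeight c b h) j s κ) +
      (∫ κ in Ioo (0 : ℝ) 1, H h κ * damping s κ * tilted (betaWeight c b h) j s κ) +
      ∫ κ in Ioo (0 : ℝ) 1, endTerm b s κ * tilted (betaWeight c b h) j s κ := by
  have i1 := (w.integrableOn_damping_mul hs j).const_mul (c + j)
  have i2 := w.integrableOn_H_mul hs j
  have i3 := w.integrableOn_endTerm_mul hs j
  have i4 := (w.integrableOn_tilted (j + 1) s).const_mul s
  have i12 : IntegrableOn (fun κ => (c + j) * (damping s κ * tilted (betaWeight c b h) j s κ) +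
      H h κ * damping s κ * tilted (betaWeight c b h) j s κ) (Ioo 0 1) := i1.add i2
  have i123 : IntegrableOn (fun κ => (c + j) * (damping s κ * tilted (betaWeight c b h) j s κ) +
      H h κ * damping s κ * tilted (betaWeight c b h) j s κ +
      endTerm b s κ * tilted (betaWeight c b h) j s κ) (Ioo 0 1) := i12.add i3
  have key := intervalIntegral.integral_eq_sub_of_hasDerivAt_of_tendsto zero_lt_one
    (fun κ hκ => w.hasDerivAt_boundary j s hκ)
    ((intervalIntegrable_iff_integrableOn_Ioo_of_le zero_le_one).2 (i123.sub i4))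
    (w.tendsto_boundary_zero j s) (w.tendsto_boundary_one j hs)
  rw [intervalIntegral.integral_of_le zero_le_one, integral_Ioc_eq_integral_Ioo,
    integral_sub i123 i4, integral_add i12 i3, integral_add i1 i2, integral_const_mul,
    integral_const_mul, sub_self, sub_eq_zero] at key
  exact key.symm

end IsRegularWeight

/-! ### The moment inequality -/

lemma tilted_succ (f : ℝ → ℝ) (j : ℕ) (s κ : ℝ) :
    tilted f (j + 1) s κ = κ * tilted f j s κ := by
  unfold tilted; ring

namespace IsRegularWeight

variable {c b : ℝ} {h : ℝ → ℝ} (w : IsRegularWeight c b h)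
include w

lemma integral_damping_le (j : ℕ) {s : ℝ} (hs : 0 ≤ s) :
    ∫ κ in Ioo (0 : ℝ) 1, damping s κ * tilted (betaWeight c b h) j s κ ≤
      tiltedMoment (betaWeight c b h) j s :=
  setIntegral_mono_on (w.integrableOn_damping_mul hs j) (w.integrableOn_tilted j s)
    measurableSet_Ioo fun κ hκ =>
      mul_le_of_le_one_left (w.tilted_pos j s κ hκ).le damping_le_one

lemma integral_H_le {η : ℝ} (hH : ∀ κ ∈ Ioo (0 : ℝ) 1, H h κ ≤ η) (j : ℕ) {s : ℝ} (hs : 0 ≤ s) :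
    ∫ κ in Ioo (0 : ℝ) 1, H h κ * damping s κ * tilted (betaWeight c b h) j s κ ≤
      η * ∫ κ in Ioo (0 : ℝ) 1, damping s κ * tilted (betaWeight c b h) j s κ := by
  rw [← integral_const_mul]
  refine setIntegral_mono_on (w.integrableOn_H_mul hs j)
    ((w.integrableOn_damping_mul hs j).const_mul η) measurableSet_Ioo fun κ hκ => ?_
  rw [mul_assoc]
  exact mul_le_mul_of_nonneg_right (hH κ hκ)
    (mul_nonneg (damping_nonneg hs hκ) (w.tilted_pos j s κ hκ).le)

lemma integral_endTerm_nonneg (j : ℕ) {s : ℝ} (hs : 0 ≤ s) :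
    0 ≤ ∫ κ in Ioo (0 : ℝ) 1, endTerm b s κ * tilted (betaWeight c b h) j s κ :=
  setIntegral_nonneg measurableSet_Ioo fun κ hκ =>
    mul_nonneg (endTerm_nonneg w.b_lt_one hs hκ) (w.tilted_pos j s κ hκ).le

lemma integral_endTerm_le (j : ℕ) {s : ℝ} (hs : 0 ≤ s) :
    ∫ κ in Ioo (0 : ℝ) 1, endTerm b s κ * tilted (betaWeight c b h) j s κ ≤
      (1 - b) * (s * tiltedMoment (betaWeight c b h) (j + 1) s) := by
  have e : (1 - b) * (s * tiltedMoment (betaWeight c b h) (j + 1) s) =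
      ∫ κ in Ioo (0 : ℝ) 1, (1 - b) * s * tilted (betaWeight c b h) (j + 1) s κ := by
    rw [integral_const_mul, mul_assoc]
    rfl
  rw [e]
  refine setIntegral_mono_on (w.integrableOn_endTerm_mul hs j)
    ((w.integrableOn_tilted (j + 1) s).const_mul _) measurableSet_Ioo fun κ hκ => ?_
  rw [tilted_succ, ← mul_assoc]
  exact mul_le_mul_of_nonneg_right (endTerm_le w.b_lt_one hκ) (w.tilted_pos j s κ hκ).le

lemma integral_tilted_zero_mul_le {g : ℝ → ℝ} {B s : ℝ} (hg : AntitoneOn g (Ioo 0 1))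
    (hB : ∀ κ ∈ Ioo (0 : ℝ) 1, |g κ| ≤ B) :
    (∫ κ in Ioo (0 : ℝ) 1, g κ * tilted (betaWeight c b h) 1 s κ) *
        tiltedMoment (betaWeight c b h) 0 s ≤
      (∫ κ in Ioo (0 : ℝ) 1, g κ * tilted (betaWeight c b h) 0 s κ) *
        tiltedMoment (betaWeight c b h) 1 s := by
  have := integral_mul_antitoneOn_le (w.integrableOn_tilted 0 s) (w.tilted_pos 0 s) hg hB
  simp_rw [← tilted_succ] at this
  exact this

/-- Integration by parts at `j = 1`, with the end-term bound `(1-b) s M₂` moved to the left-hand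
side. -/
lemma mul_tiltedMoment_two_le {η : ℝ} (hη : 0 ≤ η) (hH : ∀ κ ∈ Ioo (0 : ℝ) 1, H h κ ≤ η) {s : ℝ}
    (hs : 0 ≤ s) : b * (s * tiltedMoment (betaWeight c b h) 2 s) ≤
      (c + 1 + η) * tiltedMoment (betaWeight c b h) 1 s := by
  have h1 := w.mul_tiltedMoment_succ 1 hs
  have h2 := w.integral_H_le hH 1 hs
  have h3 := w.integral_endTerm_le 1 hs
  have h4 := w.integral_damping_le 1 hs
  norm_num at h1 h3
  have h5 := mul_le_mul_of_nonneg_left h4 (by linarith [w.nonneg] : 0 ≤ c + 1 + η)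
  linarith

/-- The differential inequality behind minimaxity, given a bound on the part of the integration
by parts that does not come from the factor `(1-κ)^(b-1)`. -/
lemma tiltedMoment_ineq_of_le {η P s : ℝ} (hη : 0 ≤ η) (hH : ∀ κ ∈ Ioo (0 : ℝ) 1, H h κ ≤ η)
    (hP : 2 * (c + 1 + η) ≤ b * (P + c)) (hs : 0 ≤ s)
    (hA : 2 * ((c + 1) * (∫ κ in Ioo (0 : ℝ) 1, damping s κ * tilted (betaWeight c b h) 1 s κ) +
        ∫ κ in Ioo (0 : ℝ) 1, H h κ * damping s κ * tilted (betaWeight c b h) 1 s κ) *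
          tiltedMoment (betaWeight c b h) 0 s -
      (c * (∫ κ in Ioo (0 : ℝ) 1, damping s κ * tilted (betaWeight c b h) 0 s κ) +
        ∫ κ in Ioo (0 : ℝ) 1, H h κ * damping s κ * tilted (betaWeight c b h) 0 s κ) *
          tiltedMoment (betaWeight c b h) 1 s ≤
      (c + 2 + 2 * η) * (tiltedMoment (betaWeight c b h) 0 s *
        tiltedMoment (betaWeight c b h) 1 s)) :
    s * (2 * tiltedMoment (betaWeight c b h) 2 s * tiltedMoment (betaWeight c b h) 0 s -
        tiltedMoment (betaWeight c b h) 1 s ^ 2) ≤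
      P * (tiltedMoment (betaWeight c b h) 0 s * tiltedMoment (betaWeight c b h) 1 s) := by
  have e1 := w.mul_tiltedMoment_succ 1 hs
  have e0 := w.mul_tiltedMoment_succ 0 hs
  have k1 := w.integral_endTerm_le 1 hs
  have k0 := w.integral_endTerm_nonneg 0 hs
  have h2 := w.mul_tiltedMoment_two_le hη hH hs
  have p0 := tiltedMoment_pos w.integrableOn w.betaWeight_pos 0 s
  have p1 := tiltedMoment_pos w.integrableOn w.betaWeight_pos 1 s
  norm_num at e0 e1 k1
  set m0 := tiltedMoment (betaWeight c b h) 0 s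
  set m1 := tiltedMoment (betaWeight c b h) 1 s
  set m2 := tiltedMoment (betaWeight c b h) 2 s
  set U1 := ∫ κ in Ioo (0 : ℝ) 1, damping s κ * tilted (betaWeight c b h) 1 s κ
  set U0 := ∫ κ in Ioo (0 : ℝ) 1, damping s κ * tilted (betaWeight c b h) 0 s κ
  set V1 := ∫ κ in Ioo (0 : ℝ) 1, H h κ * damping s κ * tilted (betaWeight c b h) 1 s κ
  set V0 := ∫ κ in Ioo (0 : ℝ) 1, H h κ * damping s κ * tilted (betaWeight c b h) 0 s κ
  set K1 := ∫ κ in Ioo (0 : ℝ) 1, endTerm b s κ * tilted (betaWeight c b h) 1 s κ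
  set K0 := ∫ κ in Ioo (0 : ℝ) 1, endTerm b s κ * tilted (betaWeight c b h) 0 s κ
  -- Both `s M₂` and `s M₁` are replaced by their integrations by parts, which separates the part
  -- bounded by `hA` from the end terms.
  have c1 : s * (2 * m2 * m0 - m1 ^ 2) =
      2 * ((c + 1) * U1 + V1) * m0 - (c * U0 + V0) * m1 + 2 * (K1 * m0) - K0 * m1 := by
    have : s * (2 * m2 * m0 - m1 ^ 2) = 2 * (s * m2) * m0 - (s * m1) * m1 := by ring
    rw [this, e1, e0]
    ring
  have c2 : K1 * m0 ≤ (1 - b) * (s * m2) * m0 := mul_le_mul_of_nonneg_right k1 p0.le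
  have c3 : 0 ≤ K0 * m1 := mul_nonneg k0 p1.le
  have c4 : s * (2 * m2 * m0 - m1 ^ 2) ≤
      (c + 2 + 2 * η) * (m0 * m1) + 2 * ((1 - b) * (s * m2) * m0) := by linarith
  have c5 : (1 - b) * m0 * (b * (s * m2)) ≤ (1 - b) * m0 * ((c + 1 + η) * m1) :=
    mul_le_mul_of_nonneg_left h2 (mul_nonneg (by linarith [w.b_lt_one]) p0.le)
  have c6 := mul_le_mul_of_nonneg_left c4 w.pos_b.le
  have c7 := mul_le_mul_of_nonneg_right hP (mul_pos p0 p1).le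
  -- The coefficients add up to `b(c+2+2η) + 2(1-b)(c+1+η) = 2(c+1+η) - bc`, which `hP` bounds by
  -- `bP`.
  have c8 : b * (s * (2 * m2 * m0 - m1 ^ 2)) ≤ b * (P * (m0 * m1)) := by nlinarith
  exact le_of_mul_le_mul_left c8 w.pos_b

/-- Here `η = 0`. One copy of `(c+1)U₁ + V₁` is completed to `(c+2)U₁ + V₁` and compared with index
`0` by Chebyshev. This cancels `V₀` and leaves `2U₀M₁ + cU₁M₀ + V₁M₀`, where `V₁ ≤ 0` and `U_j ≤
M_j`. -/
lemma tiltedMoment_ineq_of_antitoneOn {P s : ℝ} (hanti : AntitoneOn (H h) (Ioo 0 1))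
    (hH : ∀ κ ∈ Ioo (0 : ℝ) 1, H h κ ≤ 0) (hH' : ∀ κ ∈ Ioo (0 : ℝ) 1, -(c + 2) ≤ H h κ)
    (hP : 2 * (c + 1) ≤ b * (P + c)) (hs : 0 ≤ s) :
    s * (2 * tiltedMoment (betaWeight c b h) 2 s * tiltedMoment (betaWeight c b h) 0 s -
        tiltedMoment (betaWeight c b h) 1 s ^ 2) ≤
      P * (tiltedMoment (betaWeight c b h) 0 s * tiltedMoment (betaWeight c b h) 1 s) := by
  refine w.tiltedMoment_ineq_of_le le_rfl hH (by simpa using hP) hs ?_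
  have hc := w.nonneg
  -- The lower bound `H ≥ -(c+2)` makes `c + 2 + H` nonnegative, so its product with the damping is
  -- still antitone.
  have cheb := w.integral_tilted_zero_mul_le (s := s)
    (g := fun κ => (c + 2 + H h κ) * damping s κ) (B := c + 2)
    (fun x hx y hy hxy => mul_le_mul (by linarith [hanti hx hy hxy]) (damping_antitone hs hxy)
      (damping_nonneg hs hy) (by linarith [hH' x hx]))
    (fun κ hκ => by
      rw [abs_mul, abs_of_nonneg (by linarith [hH' κ hκ])]
      calc (c + 2 + H h κ) * |damping s κ| ≤ (c + 2 + H h κ) * 1 :=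
            mul_le_mul_of_nonneg_left (abs_damping_le hs hκ) (by linarith [hH' κ hκ])
        _ ≤ c + 2 := by linarith [hH κ hκ])
  have split : ∀ j, ∫ κ in Ioo (0 : ℝ) 1,
      (c + 2 + H h κ) * damping s κ * tilted (betaWeight c b h) j s κ =
      (c + 2) * (∫ κ in Ioo (0 : ℝ) 1, damping s κ * tilted (betaWeight c b h) j s κ) +
      ∫ κ in Ioo (0 : ℝ) 1, H h κ * damping s κ * tilted (betaWeight c b h) j s κ := fun j => by
    rw [← integral_const_mul, ← integral_add ((w.integrableOn_damping_mul hs j).const_mul _)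
      (w.integrableOn_H_mul hs j)]
    congr 1
    ext κ
    ring
  simp only [split] at cheb
  have hV := w.integral_H_le hH 1 hs
  have hU1 := w.integral_damping_le 1 hs
  have hU0 := w.integral_damping_le 0 hs
  have p0 := tiltedMoment_pos w.integrableOn w.betaWeight_pos 0 s
  have p1 := tiltedMoment_pos w.integrableOn w.betaWeight_pos 1 s
  rw [zero_mul] at hV
  have a1 := mul_nonneg_of_nonpos_of_nonpos hV (neg_nonpos.2 p0.le)
  have a2 := mul_le_mul_of_nonneg_right hU1 (mul_nonneg hc p0.le)
  have a3 := mul_le_mul_of_nonneg_right hU0 p1.le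
  nlinarith

/-- `V₁ ≤ ηU₁` and `V₀ ≥ 0` eliminate `H`; Chebyshev for the damping alone, `U₁M₀ ≤ U₀M₁`, then
cancels `c` of the coefficient `2(c+1+η)`. -/
lemma tiltedMoment_ineq_of_nonneg {η P s : ℝ} (hH0 : ∀ κ ∈ Ioo (0 : ℝ) 1, 0 ≤ H h κ)
    (hη : 0 ≤ η) (hH : ∀ κ ∈ Ioo (0 : ℝ) 1, H h κ ≤ η)
    (hP : 2 * (c + 1 + η) ≤ b * (P + c)) (hs : 0 ≤ s) :
    s * (2 * tiltedMoment (betaWeight c b h) 2 s * tiltedMoment (betaWeight c b h) 0 s -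
        tiltedMoment (betaWeight c b h) 1 s ^ 2) ≤
      P * (tiltedMoment (betaWeight c b h) 0 s * tiltedMoment (betaWeight c b h) 1 s) := by
  refine w.tiltedMoment_ineq_of_le hη hH hP hs ?_
  have hc := w.nonneg
  have cheb := w.integral_tilted_zero_mul_le (s := s) (g := damping s) (B := 1)
    ((damping_antitone hs).antitoneOn _) (fun κ hκ => abs_damping_le hs hκ)
  have hV1 := w.integral_H_le hH 1 hs
  have hV0 : 0 ≤ ∫ κ in Ioo (0 : ℝ) 1, H h κ * damping s κ * tilted (betaWeight c b h) 0 s κ :=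
    setIntegral_nonneg measurableSet_Ioo fun κ hκ =>
      mul_nonneg (mul_nonneg (hH0 κ hκ) (damping_nonneg hs hκ)) (w.tilted_pos 0 s κ hκ).le
  have hU1 := w.integral_damping_le 1 hs
  have p0 := tiltedMoment_pos w.integrableOn w.betaWeight_pos 0 s
  have p1 := tiltedMoment_pos w.integrableOn w.betaWeight_pos 1 s
  have a1 := mul_le_mul_of_nonneg_right hV1 p0.le
  have a2 := mul_le_mul_of_nonneg_left cheb hc
  have a3 := mul_nonneg hV0 p1.le
  have a4 := mul_le_mul_of_nonneg_right hU1
    (mul_nonneg (by linarith : 0 ≤ c + 2 + 2 * η) p0.le)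
  nlinarith

end IsRegularWeight

/-! ### Regularity of the hyperprior weight -/

lemma integrableOn_betaWeight {c b : ℝ} {h : ℝ → ℝ} (hb : 0 < b) (hb1 : b < 1)
    (hcont : ContinuousOn h (Ioc 0 1))
    (hint : IntegrableOn (fun κ => κ ^ (c - 1) * h κ) (Ioo 0 1)) :
    IntegrableOn (betaWeight c b h) (Ioo 0 1) := by
  -- The two endpoint singularities are separated at `1/2`: on the left `(1-κ)^(b-1)` is bounded, on
  -- the right `κ^(c-1) h` is continuous.
  have h1 : IntegrableOn (betaWeight c b h) (Ioo 0 (1 / 2)) := by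
    have i1 : IntegrableOn (fun κ => (1 - κ) ^ (b - 1) * (κ ^ (c - 1) * h κ)) (Ioo 0 (1 / 2)) := by
      refine Integrable.bdd_mul (c := (1 / 2 : ℝ) ^ (b - 1))
        (hint.mono_set (Ioo_subset_Ioo_right (by norm_num))) ?_ ?_
      · exact Measurable.aestronglyMeasurable (by fun_prop)
      · refine (ae_restrict_iff' measurableSet_Ioo).2 (Eventually.of_forall fun κ hκ => ?_)
        rw [Real.norm_of_nonneg (Real.rpow_nonneg (by linarith [hκ.2]) _)]
        exact Real.rpow_le_rpow_of_nonpos (by norm_num) (by linarith [hκ.2]) (by linarith)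
    refine i1.congr (Eventually.of_forall fun κ => ?_)
    simp only [betaWeight]
    ring
  have h2 : IntegrableOn (betaWeight c b h) (Icc (1 / 2) 1) := by
    have i1 : IntegrableOn (fun κ : ℝ => (1 - κ) ^ (b - 1)) (Icc (1 / 2) 1) := by
      have := (intervalIntegral.intervalIntegrable_rpow' (a := 1 / 2) (b := 0) (r := b - 1)
        (by linarith)).comp_sub_left 1
      rw [sub_zero, intervalIntegrable_iff_integrableOn_Icc_of_le (by norm_num)] at this
      norm_num at this
      norm_num
      exact this
    have i2 : ContinuousOn (fun κ => κ ^ (c - 1) * h κ) (Icc (1 / 2) 1) := by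
      refine ContinuousOn.mul (fun κ hκ => ?_)
        (hcont.mono fun κ hκ => ⟨by linarith [hκ.1], hκ.2⟩)
      exact (Real.continuousAt_rpow_const κ _
        (Or.inl (by linarith [hκ.1] : (0 : ℝ) < κ).ne')).continuousWithinAt
    refine (i1.continuousOn_mul i2 isCompact_Icc).congr (Eventually.of_forall fun κ => ?_)
    simp only [betaWeight]
    ring
  refine (h1.union h2).mono_set fun κ hκ => ?_
  rcases lt_or_ge κ (1 / 2) with hk | hk
  · exact Or.inl ⟨hκ.1, hk⟩
  · exact Or.inr ⟨hk, hκ.2.le⟩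

namespace IsAdmissible

variable {h : ℝ → ℝ} (hh : IsAdmissible h)
include hh

lemma hasDerivAt {κ : ℝ} (hκ : κ ∈ Ioo (0 : ℝ) 1) : HasDerivAt h (H h κ * h κ / κ) κ := by
  have hp := hh.pos κ ⟨hκ.1, hκ.2.le⟩
  have h1 := ((hh.differentiableOn κ ⟨hκ.1, hκ.2.le⟩).hasDerivWithinAt.hasDerivAt
    (Ioc_mem_nhds hκ.1 hκ.2))
  refine h1.congr_deriv ?_
  have := hκ.1
  unfold H
  field_simp

lemma tendsto_one : Tendsto h (𝓝[<] 1) (𝓝 (h 1)) := by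
  have := (hh.differentiableOn.continuousOn 1 ⟨one_pos, le_rfl⟩).mono Ioo_subset_Ioc_self
  rw [ContinuousWithinAt, nhdsWithin_Ioo_eq_nhdsLT zero_lt_one] at this
  exact this

/-- An antitone function lies below its limit at the left end, here `0`. -/
lemma H_nonpos (hanti : AntitoneOn (H h) (Ioc 0 1)) {κ : ℝ} (hκ : κ ∈ Ioc (0 : ℝ) 1) :
    H h κ ≤ 0 := by
  refine ge_of_tendsto hh.tendsto_H ?_
  filter_upwards [Ioo_mem_nhdsGT hκ.1] with x hx
  exact hanti ⟨hx.1, hx.2.le.trans hκ.2⟩ hκ hx.2.le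

lemma H_nonneg (hmono : MonotoneOn (H h) (Ioc 0 1)) {κ : ℝ} (hκ : κ ∈ Ioc (0 : ℝ) 1) :
    0 ≤ H h κ := by
  refine le_of_tendsto hh.tendsto_H ?_
  filter_upwards [Ioo_mem_nhdsGT hκ.1] with x hx
  exact hmono ⟨hx.1, hx.2.le.trans hκ.2⟩ hκ hx.2.le

lemma antitoneOn (hH : ∀ κ ∈ Ioo (0 : ℝ) 1, H h κ ≤ 0) : AntitoneOn h (Ioc 0 1) := by
  refine antitoneOn_of_deriv_nonpos (convex_Ioc 0 1) hh.differentiableOn.continuousOn ?_ ?_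
  · exact hh.differentiableOn.mono interior_subset
  · rw [interior_Ioc]
    intro κ hκ
    rw [(hh.hasDerivAt hκ).deriv]
    exact div_nonpos_of_nonpos_of_nonneg
      (mul_nonpos_of_nonpos_of_nonneg (hH κ hκ) (hh.pos κ ⟨hκ.1, hκ.2.le⟩).le) hκ.1.le

lemma monotoneOn (hH : ∀ κ ∈ Ioo (0 : ℝ) 1, 0 ≤ H h κ) : MonotoneOn h (Ioc 0 1) := by
  refine monotoneOn_of_deriv_nonneg (convex_Ioc 0 1) hh.differentiableOn.continuousOn ?_ ?_
  · exact hh.differentiableOn.mono interior_subset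
  · rw [interior_Ioc]
    intro κ hκ
    rw [(hh.hasDerivAt hκ).deriv]
    exact div_nonneg (mul_nonneg (hH κ hκ) (hh.pos κ ⟨hκ.1, hκ.2.le⟩).le) hκ.1.le

/-- The derivative of `κ^ε h` is `κ^(ε-1) h (ε + H)`, positive near `0` because `H → 0`; away from
`0`, `h` itself is bounded since it is antitone. -/
lemma rpow_mul_le_of_antitone (hH : ∀ κ ∈ Ioo (0 : ℝ) 1, H h κ ≤ 0) {ε : ℝ} (hε : 0 < ε) :
    ∃ C, ∀ κ ∈ Ioo (0 : ℝ) 1, κ ^ ε * h κ ≤ C := by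
  have hev : ∀ᶠ κ in 𝓝[>] (0 : ℝ), -ε < H h κ := hh.tendsto_H.eventually (lt_mem_nhds (by linarith))
  obtain ⟨δ', hδ', hδ⟩ := mem_nhdsGT_iff_exists_Ioo_subset.1 hev
  set δ := min δ' (1 / 2) with hδd
  have hδ0 : 0 < δ := lt_min hδ' (by norm_num)
  have hδ1 : δ < 1 := (min_le_right _ _).trans_lt (by norm_num)
  have hder : ∀ κ ∈ Ioo 0 δ, HasDerivAt (fun κ => κ ^ ε * h κ) (κ ^ (ε - 1) * h κ * (ε + H h κ)) κ := by
    intro κ hκ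
    have hκ0 : κ ≠ 0 := hκ.1.ne'
    refine ((Real.hasDerivAt_rpow_const (Or.inl hκ0)).mul
      (hh.hasDerivAt ⟨hκ.1, hκ.2.trans hδ1⟩)).congr_deriv ?_
    rw [Real.rpow_sub_one hκ0]
    field_simp
  have hmono : MonotoneOn (fun κ => κ ^ ε * h κ) (Ioc 0 δ) := by
    refine monotoneOn_of_deriv_nonneg (convex_Ioc 0 δ) ?_ ?_ ?_
    · refine ContinuousOn.mul (fun κ hκ => ?_) (hh.differentiableOn.continuousOn.mono
        (Ioc_subset_Ioc_right hδ1.le))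
      exact (Real.continuousAt_rpow_const κ ε (Or.inl hκ.1.ne')).continuousWithinAt
    · rw [interior_Ioc]
      exact fun κ hκ => (hder κ hκ).differentiableAt.differentiableWithinAt
    · rw [interior_Ioc]
      intro κ hκ
      rw [(hder κ hκ).deriv]
      have h1 : -ε < H h κ := hδ ⟨hκ.1, hκ.2.trans_le (min_le_left _ _)⟩
      have h2 := hh.pos κ ⟨hκ.1, (hκ.2.trans hδ1).le⟩
      exact mul_nonneg (mul_nonneg (Real.rpow_nonneg hκ.1.le _) h2.le) (by linarith)
  have hδp := hh.pos δ ⟨hδ0, hδ1.le⟩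
  refine ⟨h δ, fun κ hκ => ?_⟩
  rcases le_total κ δ with hk | hk
  · refine (hmono ⟨hκ.1, hk⟩ ⟨hδ0, le_rfl⟩ hk).trans ?_
    exact mul_le_of_le_one_left hδp.le (Real.rpow_le_one hδ0.le hδ1.le hε.le)
  · refine le_trans ?_ (hh.antitoneOn hH ⟨hδ0, hδ1.le⟩ ⟨hκ.1, hκ.2.le⟩ hk)
    exact mul_le_of_le_one_left (hh.pos κ ⟨hκ.1, hκ.2.le⟩).le
      (Real.rpow_le_one hκ.1.le hκ.2.le hε.le)

lemma rpow_mul_le_of_monotone (hH : ∀ κ ∈ Ioo (0 : ℝ) 1, 0 ≤ H h κ) {ε : ℝ} (hε : 0 < ε) :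
    ∃ C, ∀ κ ∈ Ioo (0 : ℝ) 1, κ ^ ε * h κ ≤ C := by
  refine ⟨h 1, fun κ hκ => ?_⟩
  refine le_trans ?_ (hh.monotoneOn hH ⟨hκ.1, hκ.2.le⟩ ⟨one_pos, le_rfl⟩ hκ.2.le)
  exact mul_le_of_le_one_left (hh.pos κ ⟨hκ.1, hκ.2.le⟩).le
    (Real.rpow_le_one hκ.1.le hκ.2.le hε.le)

/-- Half of the exponent keeps `h` bounded; the other half supplies the decay. -/
lemma tendsto_rpow_mul {c : ℝ} (hc : 0 < c)
    (hbd : ∃ C, ∀ κ ∈ Ioo (0 : ℝ) 1, κ ^ (c / 2) * h κ ≤ C) :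
    Tendsto (fun κ => κ ^ c * h κ) (𝓝[>] 0) (𝓝 0) := by
  obtain ⟨C, hC⟩ := hbd
  have t1 : Tendsto (fun κ : ℝ => κ ^ (c / 2) * C) (𝓝[>] 0) (𝓝 0) := by
    have : ContinuousAt (fun κ : ℝ => κ ^ (c / 2) * C) 0 :=
      (Real.continuousAt_rpow_const 0 (c / 2) (Or.inr (by linarith))).mul continuousAt_const
    simpa [Real.zero_rpow (half_pos hc).ne'] using
      this.tendsto.mono_left (nhdsWithin_le_nhds (s := Ioi 0))
  have hev : ∀ᶠ κ : ℝ in 𝓝[>] 0, κ ∈ Ioo (0 : ℝ) 1 := Ioo_mem_nhdsGT zero_lt_one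
  refine tendsto_of_tendsto_of_tendsto_of_le_of_le' tendsto_const_nhds t1 ?_ ?_
  · filter_upwards [hev] with κ hκ
    exact mul_nonneg (Real.rpow_nonneg hκ.1.le _) (hh.pos κ ⟨hκ.1, hκ.2.le⟩).le
  · filter_upwards [hev] with κ hκ
    have : κ ^ c = κ ^ (c / 2) * κ ^ (c / 2) := by
      rw [← Real.rpow_add hκ.1]; ring_nf
    rw [this, mul_assoc]
    exact mul_le_mul_of_nonneg_left (hC κ hκ) (Real.rpow_nonneg hκ.1.le _)

lemma integrableOn_rpow_mul {c : ℝ} (hc : 0 < c)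
    (hbd : ∃ C, ∀ κ ∈ Ioo (0 : ℝ) 1, κ ^ (c / 2) * h κ ≤ C) :
    IntegrableOn (fun κ => κ ^ (c - 1) * h κ) (Ioo 0 1) := by
  obtain ⟨C, hC⟩ := hbd
  have i1 : IntegrableOn (fun κ : ℝ => κ ^ (c / 2 - 1) * C) (Ioo 0 1) :=
    Integrable.mul_const ((intervalIntegral.integrableOn_Ioo_rpow_iff one_pos).2 (by linarith)) C
  refine Integrable.mono' i1 ?_ ((ae_restrict_iff' measurableSet_Ioo).2
    (Eventually.of_forall fun κ hκ => ?_))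
  · refine (ContinuousOn.mul (fun κ hκ => ?_) (hh.differentiableOn.continuousOn.mono
      Ioo_subset_Ioc_self)).aestronglyMeasurable measurableSet_Ioo
    exact (Real.continuousAt_rpow_const κ _ (Or.inl hκ.1.ne')).continuousWithinAt
  · rw [Real.norm_of_nonneg (mul_nonneg (Real.rpow_nonneg hκ.1.le _)
      (hh.pos κ ⟨hκ.1, hκ.2.le⟩).le)]
    have : κ ^ (c - 1) = κ ^ (c / 2 - 1) * κ ^ (c / 2) := by
      rw [← Real.rpow_add hκ.1]; ring_nf
    rw [this, mul_assoc]
    exact mul_le_mul_of_nonneg_left (hC κ hκ) (Real.rpow_nonneg hκ.1.le _)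

omit hh in
lemma not_integrableOn_inv_mul {L : ℝ} (hL : 0 < L)
    (hLh : ∀ κ ∈ Ioo (0 : ℝ) 1, L ≤ h κ) : ¬ IntegrableOn (fun κ => κ⁻¹ * h κ) (Ioo 0 1) := by
  intro hi
  have i1 : IntegrableOn (fun κ : ℝ => κ ^ (-1 : ℝ)) (Ioo 0 1) := by
    refine Integrable.mono' (hi.const_mul L⁻¹)
      (Measurable.aestronglyMeasurable (by fun_prop))
      ((ae_restrict_iff' measurableSet_Ioo).2 (Eventually.of_forall fun κ hκ => ?_))
    have h0 := hκ.1
    rw [Real.norm_of_nonneg (Real.rpow_nonneg hκ.1.le _), Real.rpow_neg_one]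
    have := hLh κ hκ
    calc κ⁻¹ = L⁻¹ * (κ⁻¹ * L) := by field_simp
      _ ≤ L⁻¹ * (κ⁻¹ * h κ) := by gcongr
  rw [intervalIntegral.integrableOn_Ioo_rpow_iff one_pos] at i1
  exact lt_irrefl _ i1

lemma isRegularWeight {c b : ℝ} (hc : 0 ≤ c) (hb : 0 < b) (hb1 : b < 1)
    (hint : IntegrableOn (fun κ => κ ^ (c - 1) * h κ) (Ioo 0 1))
    (hlim : Tendsto (fun κ => κ ^ c * h κ) (𝓝[>] 0) (𝓝 0))
    (hm : AEStronglyMeasurable (H h) (volume.restrict (Ioo 0 1)))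
    (hB : ∃ B, ∀ κ ∈ Ioo (0 : ℝ) 1, |H h κ| ≤ B) : IsRegularWeight c b h where
  nonneg := hc
  pos_b := hb
  b_lt_one := hb1
  pos := fun κ hκ => hh.pos κ ⟨hκ.1, hκ.2.le⟩
  hasDerivAt := fun _ hκ => hh.hasDerivAt hκ
  integrableOn := integrableOn_betaWeight hb hb1 hh.differentiableOn.continuousOn hint
  tendsto_zero := hlim
  tendsto_one := hh.tendsto_one
  measurable_H := hm
  bounded_H := hB

lemma isRegularWeight_of_antitoneOn {c b : ℝ} (hanti : AntitoneOn (H h) (Ioc 0 1))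
    (hc : 0 ≤ c) (hb : 0 < b) (hb1 : b < 1)
    (hfin : c = 0 → IntegrableOn (fun κ : ℝ => κ⁻¹ * h κ) (Ioo 0 1)) :
    IsRegularWeight c b h := by
  have hH : ∀ κ ∈ Ioo (0 : ℝ) 1, H h κ ≤ 0 := fun κ hκ => hh.H_nonpos hanti ⟨hκ.1, hκ.2.le⟩
  -- `h` is antitone, so `h ≥ h 1 > 0` and `κ⁻¹ h` is not integrable; this excludes `c = 0`.
  have hc0 : 0 < c := by
    refine lt_of_le_of_ne hc fun h0 => ?_
    refine not_integrableOn_inv_mul (hh.pos 1 ⟨one_pos, le_rfl⟩) (fun κ hκ => ?_)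
      (hfin h0.symm)
    exact hh.antitoneOn hH ⟨hκ.1, hκ.2.le⟩ ⟨one_pos, le_rfl⟩ hκ.2.le
  have hbd := hh.rpow_mul_le_of_antitone hH (half_pos hc0)
  refine hh.isRegularWeight hc hb hb1 (hh.integrableOn_rpow_mul hc0 hbd)
    (hh.tendsto_rpow_mul hc0 hbd)
    (aemeasurable_restrict_of_antitoneOn measurableSet_Ioo
      (hanti.mono Ioo_subset_Ioc_self)).aestronglyMeasurable ⟨-H h 1, fun κ hκ => ?_⟩
  rw [abs_of_nonpos (hH κ hκ)]
  exact neg_le_neg (hanti ⟨hκ.1, hκ.2.le⟩ ⟨one_pos, le_rfl⟩ hκ.2.le)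

/-- Now `c = 0` can occur; integrability of `κ⁻¹ h` then forces the monotone `h` to vanish at `0`,
which is the boundary condition needed. -/
lemma isRegularWeight_of_monotoneOn {c b : ℝ} (hmono : MonotoneOn (H h) (Ioc 0 1))
    (hc : 0 ≤ c) (hb : 0 < b) (hb1 : b < 1)
    (hfin : c = 0 → IntegrableOn (fun κ : ℝ => κ⁻¹ * h κ) (Ioo 0 1)) :
    IsRegularWeight c b h := by
  have hH : ∀ κ ∈ Ioo (0 : ℝ) 1, 0 ≤ H h κ := fun κ hκ => hh.H_nonneg hmono ⟨hκ.1, hκ.2.le⟩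
  have hm : AEStronglyMeasurable (H h) (volume.restrict (Ioo 0 1)) :=
    (aemeasurable_restrict_of_monotoneOn measurableSet_Ioo
      (hmono.mono Ioo_subset_Ioc_self)).aestronglyMeasurable
  have hB : ∃ B, ∀ κ ∈ Ioo (0 : ℝ) 1, |H h κ| ≤ B := ⟨H h 1, fun κ hκ => by
    rw [abs_of_nonneg (hH κ hκ)]
    exact hmono ⟨hκ.1, hκ.2.le⟩ ⟨one_pos, le_rfl⟩ hκ.2.le⟩
  rcases hc.eq_or_lt with h0 | hc0
  · have hi := hfin h0.symm
    refine hh.isRegularWeight hc hb hb1 ?_ ?_ hm hB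
    · simpa [← h0, Real.rpow_neg_one] using hi
    · simp only [← h0, Real.rpow_zero, one_mul]
      refine tendsto_order.2 ⟨fun r hr => ?_, fun r hr => ?_⟩
      · filter_upwards [Ioo_mem_nhdsGT (zero_lt_one (α := ℝ))] with κ hκ
        exact hr.trans (hh.pos κ ⟨hκ.1, hκ.2.le⟩)
      -- A single value of `h` below `r` would keep `h` below `r` all the way to `0`; otherwise `h ≥
      -- r` on `(0, 1)`, contradicting integrability.
      · by_contra hcon
        refine not_integrableOn_inv_mul hr (fun κ hκ => ?_) hi
        by_contra! hlt
        apply hcon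
        filter_upwards [Ioo_mem_nhdsGT hκ.1] with x hx
        exact (hh.monotoneOn hH ⟨hx.1, (hx.2.trans hκ.2).le⟩ ⟨hκ.1, hκ.2.le⟩ hx.2.le).trans_lt hlt
  · have hbd := hh.rpow_mul_le_of_monotone hH (half_pos hc0)
    exact hh.isRegularWeight hc hb hb1 (hh.integrableOn_rpow_mul hc0 hbd)
      (hh.tendsto_rpow_mul hc0 hbd) hm hB

end IsAdmissible

/-! ### Non-monotonicity of the shrinkage function -/

/-- Half the shrinkage function, as a function of `s = w / 2`. -/
noncomputable def momentRatio (f : ℝ → ℝ) (s : ℝ) : ℝ := s * (tiltedMoment f 1 s / tiltedMoment f 0 s)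

lemma not_antitoneOn_momentRatio {f : ℝ → ℝ} (hf : IntegrableOn f (Ioo 0 1))
    (hpos : ∀ κ ∈ Ioo (0 : ℝ) 1, 0 < f κ) : ¬ AntitoneOn (momentRatio f) (Ioi 0) := by
  intro hanti
  have hp : ∀ s, 0 < s → 0 < momentRatio f s ∧ momentRatio f s < s := fun s hs => by
    have h0 := tiltedMoment_pos hf hpos 0 s
    have h1 := tiltedMoment_pos hf hpos 1 s
    refine ⟨by unfold momentRatio; positivity, mul_lt_of_lt_one_right hs ?_⟩
    rw [div_lt_one h0]
    exact tiltedMoment_succ_lt hf hpos 0 s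
  have h1 := (hp 1 one_pos)
  -- With `ψ` the moment ratio and `t = ψ(1) < 1`, one gets `ψ(t) < t = ψ(1)`, which an antitone `ψ`
  -- forbids.
  have h2 := hp (momentRatio f 1) h1.1
  have h3 := hanti (mem_Ioi.2 h1.1) (mem_Ioi.2 one_pos) h1.2.le
  linarith

namespace IsRegularWeight

variable {c b : ℝ} {h : ℝ → ℝ} (w : IsRegularWeight c b h)
include w

lemma momentRatio_eq {s : ℝ} (hs : 0 ≤ s) :
    momentRatio (betaWeight c b h) s * tiltedMoment (betaWeight c b h) 0 s =
      c * (∫ κ in Ioo (0 : ℝ) 1, damping s κ * tilted (betaWeight c b h) 0 s κ) +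
      ∫ κ in Ioo (0 : ℝ) 1, (H h κ * damping s κ + endTerm b s κ) *
        tilted (betaWeight c b h) 0 s κ := by
  have e0 := w.mul_tiltedMoment_succ 0 hs
  have h0 := tiltedMoment_pos w.integrableOn w.betaWeight_pos 0 s
  simp_rw [add_mul]
  rw [integral_add (w.integrableOn_H_mul hs 0) (w.integrableOn_endTerm_mul hs 0), ← add_assoc]
  simp only [CharP.cast_eq_zero, add_zero, zero_add] at e0
  rw [← e0, momentRatio, mul_assoc, div_mul_cancel₀ _ h0.ne']

/-- After integration by parts, the claim is that the `H` and end terms outweigh `c(M₀ - U₀) = c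
e^(-s) F`. The end term on `(0, 1/2)` alone contributes at least `e^(-s/2) A`, which wins for large
`s`. -/
lemma exists_lt_momentRatio (hH : ∀ κ ∈ Ioo (0 : ℝ) 1, 0 ≤ H h κ) :
    ∃ s, 0 < s ∧ c < momentRatio (betaWeight c b h) s := by
  set f := betaWeight c b h with hfdef
  -- `d` bounds the damping from below on `(0, 1/2)` once `s ≥ 1`.
  set d : ℝ := 1 - Real.exp (-(1 / 2)) with hd
  have hd0 : 0 < d := by
    rw [hd, sub_pos]; exact Real.exp_lt_one_iff.2 (by norm_num)
  have hb1 : 0 < 1 - b := sub_pos.2 w.b_lt_one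
  have hsub : Ioo (0 : ℝ) (1 / 2) ⊆ Ioo 0 1 := Ioo_subset_Ioo_right (by norm_num)
  have iκ : IntegrableOn (fun κ => κ * f κ) (Ioo 0 1) :=
    integrableOn_bdd_mul w.integrableOn (B := 1) (by fun_prop) fun κ hκ => by
      rw [abs_of_pos hκ.1]; exact hκ.2.le
  set A := (1 - b) * d * ∫ κ in Ioo (0 : ℝ) (1 / 2), κ * f κ with hA
  have hA0 : 0 < A := mul_pos (mul_pos hb1 hd0) (setIntegral_Ioo_pos (by norm_num)
    (iκ.mono_set hsub) fun κ hκ => mul_pos hκ.1 (w.betaWeight_pos κ (hsub hκ)))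
  set F := ∫ κ in Ioo (0 : ℝ) 1, f κ with hF
  obtain ⟨s, hs1, hs⟩ : ∃ s : ℝ, 1 ≤ s ∧ c * F < A * Real.exp (s / 2) := by
    have t : Tendsto (fun s : ℝ => A * Real.exp (s / 2)) atTop atTop :=
      (Real.tendsto_exp_atTop.comp (tendsto_id.atTop_div_const two_pos)).const_mul_atTop hA0
    exact ((eventually_ge_atTop 1).and (t.eventually_gt_atTop (c * F))).exists
  have hs0 : 0 ≤ s := by linarith
  refine ⟨s, by linarith, ?_⟩
  have h0 := tiltedMoment_pos w.integrableOn w.betaWeight_pos 0 s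
  rw [← mul_lt_mul_iff_of_pos_right h0, w.momentRatio_eq hs0]
  have e1 : ∫ κ in Ioo (0 : ℝ) 1, damping s κ * tilted f 0 s κ =
      tiltedMoment f 0 s - Real.exp (-s) * F := by
    have e : (∫ κ in Ioo (0 : ℝ) 1, tilted f 0 s κ - Real.exp (-s) * f κ) =
        tiltedMoment f 0 s - ∫ κ in Ioo (0 : ℝ) 1, Real.exp (-s) * f κ :=
      integral_sub (w.integrableOn_tilted 0 s) (w.integrableOn.const_mul _)
    rw [hF, ← integral_const_mul, ← e]
    congr 1
    ext κ
    have : Real.exp (-s) = Real.exp (-(s * (1 - κ))) * Real.exp (-(s * κ)) := by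
      rw [← Real.exp_add]; ring_nf
    rw [this, damping, tilted]
    ring
  have i2 : IntegrableOn (fun κ => (H h κ * damping s κ + endTerm b s κ) * tilted f 0 s κ)
      (Ioo 0 1) := by
    simp_rw [add_mul]
    exact (w.integrableOn_H_mul hs0 0).add (w.integrableOn_endTerm_mul hs0 0)
  have e2 : Real.exp (-(s / 2)) * A ≤
      ∫ κ in Ioo (0 : ℝ) 1, (H h κ * damping s κ + endTerm b s κ) * tilted f 0 s κ := by
    rw [hA, ← integral_const_mul, ← integral_const_mul]
    refine le_trans (setIntegral_mono_on (((iκ.mono_set hsub).const_mul _).const_mul _)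
      (i2.mono_set hsub) measurableSet_Ioo fun κ hκ => ?_)
      (setIntegral_mono_set i2 ?_ (Eventually.of_forall hsub))
    · have hκ' := hsub hκ
      have hf0 := w.betaWeight_pos κ hκ'
      have hκ0 := hκ.1
      have a1 : (1 - b) * κ * d ≤ endTerm b s κ := by
        unfold endTerm
        have b1 : κ ≤ κ / (1 - κ) := by
          rw [le_div_iff₀ (sub_pos.2 hκ'.2)]
          nlinarith
        have b2 : d ≤ damping s κ := by
          rw [hd, damping]
          have : 1 / 2 ≤ s * (1 - κ) := by nlinarith [hκ.2]
          gcongr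
        have b3 : 0 ≤ (1 - b) * (κ / (1 - κ)) := mul_nonneg hb1.le (hκ0.le.trans b1)
        exact mul_le_mul (mul_le_mul_of_nonneg_left b1 hb1.le) b2 hd0.le b3
      have a2 : 0 ≤ H h κ * damping s κ := mul_nonneg (hH κ hκ') (damping_nonneg hs0 hκ')
      have a3 : Real.exp (-(s / 2)) ≤ Real.exp (-(s * κ)) := by
        have : s * κ ≤ s / 2 := by nlinarith [hκ.2]
        gcongr
      calc Real.exp (-(s / 2)) * ((1 - b) * d * (κ * f κ))
          = ((1 - b) * κ * d) * (Real.exp (-(s / 2)) * f κ) := by ring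
        _ ≤ (H h κ * damping s κ + endTerm b s κ) * (Real.exp (-(s * κ)) * f κ) := by
            have a4 : 0 ≤ (1 - b) * κ * d := by positivity
            have a5 : 0 ≤ H h κ * damping s κ + endTerm b s κ := by linarith
            gcongr
            linarith
        _ = _ := by simp [tilted]
    · refine (ae_restrict_iff' measurableSet_Ioo).2 (Eventually.of_forall fun κ hκ => ?_)
      exact mul_nonneg (add_nonneg (mul_nonneg (hH κ hκ) (damping_nonneg hs0 hκ))
        (endTerm_nonneg w.b_lt_one hs0 hκ)) (w.tilted_pos 0 s κ hκ).le
  have e3 : c * (Real.exp (-s) * F) < Real.exp (-(s / 2)) * A := by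
    have : Real.exp (-(s / 2)) * A = Real.exp (-s) * (A * Real.exp (s / 2)) := by
      have : Real.exp (-(s / 2)) = Real.exp (-s) * Real.exp (s / 2) := by
        rw [← Real.exp_add]; ring_nf
      rw [this]; ring
    rw [this]
    calc c * (Real.exp (-s) * F) = Real.exp (-s) * (c * F) := by ring
      _ < _ := mul_lt_mul_of_pos_left hs (Real.exp_pos _)
  rw [e1]
  linarith

/-- A Laplace-type argument: the tilted mass concentrates at `κ = 0`, where both `H` and the end
term are small, so only `c` survives. -/
lemma eventually_momentRatio_le (hH : ∀ κ ∈ Ioo (0 : ℝ) 1, 0 ≤ H h κ)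
    (hlim : Tendsto (H h) (𝓝[>] 0) (𝓝 0)) {η : ℝ} (hη : 0 < η) :
    ∀ᶠ s in atTop, momentRatio (betaWeight c b h) s ≤ c + 4 * η := by
  set f := betaWeight c b h with hfdef
  obtain ⟨B, hB⟩ := w.bounded_H
  obtain ⟨ε', hε', hε⟩ := mem_nhdsGT_iff_exists_Ioo_subset.1
    (hlim.eventually (gt_mem_nhds hη))
  -- On `(0, ε)`, `H < η` and the end term is at most `κ/(1-κ) ≤ 2η`, together `3η`; the fourth `η`
  -- pays for `κ ≥ ε`.
  set ε := min ε' (min η (1 / 2)) with hεd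
  have hε0 : 0 < ε := lt_min hε' (lt_min hη (by norm_num))
  have hε1 : ε ≤ ε' := min_le_left _ _
  have hε2 : ε ≤ η := (min_le_right _ _).trans (min_le_left _ _)
  have hε3 : ε ≤ 1 / 2 := (min_le_right _ _).trans (min_le_right _ _)
  have hsub : Ioo (0 : ℝ) (ε / 2) ⊆ Ioo 0 1 := Ioo_subset_Ioo_right (by linarith)
  set A := ∫ κ in Ioo (0 : ℝ) (ε / 2), f κ with hA
  have hA0 : 0 < A := setIntegral_Ioo_pos (by linarith) (w.integrableOn.mono_set hsub)
    fun κ hκ => w.betaWeight_pos κ (hsub hκ)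
  set F := ∫ κ in Ioo (0 : ℝ) 1, f κ with hF
  have t : Tendsto (fun s : ℝ => (B + s) * Real.exp (-(ε / 2 * s)) * F) atTop (𝓝 0) := by
    have t1 : Tendsto (fun s : ℝ => s * Real.exp (-(ε / 2) * s)) atTop (𝓝 0) := by
      simpa using tendsto_rpow_mul_exp_neg_mul_atTop_nhds_zero 1 (ε / 2) (by linarith)
    have t2 : Tendsto (fun s : ℝ => Real.exp (-(ε / 2) * s)) atTop (𝓝 0) := by
      simpa using tendsto_rpow_mul_exp_neg_mul_atTop_nhds_zero 0 (ε / 2) (by linarith)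
    have := ((t2.const_mul B).add t1).mul_const F
    simp only [mul_zero, add_zero, zero_mul] at this
    refine this.congr fun s => ?_
    rw [neg_mul]
    ring
  filter_upwards [eventually_ge_atTop 0, t.eventually (gt_mem_nhds (mul_pos hη hA0))] with s hs hts
  have h0 := tiltedMoment_pos w.integrableOn w.betaWeight_pos 0 s
  have i1 := w.integrableOn_tilted 0 s
  have i2 : IntegrableOn (fun κ => (H h κ * damping s κ + endTerm b s κ) * tilted f 0 s κ)
      (Ioo 0 1) := by
    simp_rw [add_mul]
    exact (w.integrableOn_H_mul hs 0).add (w.integrableOn_endTerm_mul hs 0)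
  have hBnn : 0 ≤ B := (abs_nonneg _).trans (hB (1 / 2) (by norm_num))
  have e1 : ∫ κ in Ioo (0 : ℝ) 1, (H h κ * damping s κ + endTerm b s κ) * tilted f 0 s κ ≤
      3 * η * tiltedMoment f 0 s + (B + s) * Real.exp (-(s * ε)) * F := by
    have : 3 * η * tiltedMoment f 0 s + (B + s) * Real.exp (-(s * ε)) * F =
        ∫ κ in Ioo (0 : ℝ) 1, (3 * η * tilted f 0 s κ + (B + s) * Real.exp (-(s * ε)) * f κ) := by
      rw [integral_add (i1.const_mul _) (w.integrableOn.const_mul _), integral_const_mul,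
        integral_const_mul]
      rfl
    rw [this]
    refine setIntegral_mono_on i2 ((i1.const_mul _).add (w.integrableOn.const_mul _))
      measurableSet_Ioo fun κ hκ => ?_
    have hf0 := w.betaWeight_pos κ hκ
    have ht0 := w.tilted_pos 0 s κ hκ
    have hκ0 := hκ.1
    have hb0 := w.pos_b
    have hb1 := w.b_lt_one
    have hu0 := damping_nonneg hs hκ
    have hu1 := damping_le_one (s := s) (κ := κ)
    have a1 : H h κ * damping s κ ≤ H h κ := mul_le_of_le_one_right (hH κ hκ) hu1
    rcases lt_or_ge κ ε with hk | hk
    · have a2 : H h κ < η := hε ⟨hκ0, hk.trans_le hε1⟩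
      have a3 : endTerm b s κ ≤ 2 * η := by
        have b1 : κ / (1 - κ) ≤ 2 * η := by
          rw [div_le_iff₀ (by linarith)]
          nlinarith
        have b2 : 0 ≤ κ / (1 - κ) := div_nonneg hκ0.le (by linarith)
        calc endTerm b s κ ≤ 1 * (2 * η) * 1 := by
              unfold endTerm
              gcongr
              linarith
          _ = 2 * η := by ring
      have a4 : 0 ≤ (B + s) * Real.exp (-(s * ε)) * f κ := by positivity
      have a5 : (H h κ * damping s κ + endTerm b s κ) * tilted f 0 s κ ≤
          3 * η * tilted f 0 s κ := by
        gcongr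
        linarith
      linarith
    · have a2 : H h κ ≤ B := (le_abs_self _).trans (hB κ hκ)
      have a3 : endTerm b s κ ≤ s := by
        refine (le_abs_self _).trans ((abs_endTerm_le hb1 hs hκ).trans ?_)
        exact mul_le_of_le_one_left hs (by linarith)
      have a4 : tilted f 0 s κ ≤ Real.exp (-(s * ε)) * f κ := by
        simp only [tilted, pow_zero, one_mul]
        gcongr
      have a5 : 0 ≤ 3 * η * tilted f 0 s κ := by positivity
      have a6 : (H h κ * damping s κ + endTerm b s κ) * tilted f 0 s κ ≤
          (B + s) * (Real.exp (-(s * ε)) * f κ) := by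
        gcongr
        linarith
      linarith
  -- Mass on `(0, ε/2)` gives `M₀` a lower bound decaying only like `e^(-εs/2)`, which beats the
  -- tail's `(B+s) e^(-εs)`.
  have e2 : Real.exp (-(ε / 2 * s)) * A ≤ tiltedMoment f 0 s := by
    rw [hA, ← integral_const_mul]
    refine le_trans (setIntegral_mono_on ((w.integrableOn.mono_set hsub).const_mul _)
      (i1.mono_set hsub) measurableSet_Ioo fun κ hκ => ?_)
      (setIntegral_mono_set i1 ?_ (Eventually.of_forall hsub))
    · have hf0 := w.betaWeight_pos κ (hsub hκ)
      have : s * κ ≤ ε / 2 * s := by nlinarith [hκ.2]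
      simp only [tilted, pow_zero, one_mul]
      gcongr
    · exact (ae_restrict_iff' measurableSet_Ioo).2 (Eventually.of_forall fun κ hκ =>
        (w.tilted_pos 0 s κ hκ).le)
  have e3 : (B + s) * Real.exp (-(s * ε)) * F ≤ η * tiltedMoment f 0 s := by
    have : Real.exp (-(s * ε)) = Real.exp (-(ε / 2 * s)) * Real.exp (-(ε / 2 * s)) := by
      rw [← Real.exp_add]; ring_nf
    calc (B + s) * Real.exp (-(s * ε)) * F
        = Real.exp (-(ε / 2 * s)) * ((B + s) * Real.exp (-(ε / 2 * s)) * F) := by rw [this]; ring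
      _ ≤ Real.exp (-(ε / 2 * s)) * (η * A) := by gcongr
      _ = η * (Real.exp (-(ε / 2 * s)) * A) := by ring
      _ ≤ _ := by gcongr
  rw [← mul_le_mul_iff_of_pos_right h0, w.momentRatio_eq hs]
  have e4 := mul_le_mul_of_nonneg_left (w.integral_damping_le 0 hs) w.nonneg
  linarith

lemma not_monotoneOn_momentRatio (hH : ∀ κ ∈ Ioo (0 : ℝ) 1, 0 ≤ H h κ)
    (hlim : Tendsto (H h) (𝓝[>] 0) (𝓝 0)) :
    ¬ MonotoneOn (momentRatio (betaWeight c b h)) (Ioi 0) := by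
  intro hmono
  obtain ⟨s₀, hs₀, hlt⟩ := w.exists_lt_momentRatio hH
  -- With this `η` the eventual bound `c + 4η` is the midpoint of `c` and the value at `s₀`, hence
  -- strictly below that value.
  obtain ⟨s, hs, hle⟩ := ((w.eventually_momentRatio_le hH hlim
    (η := (momentRatio (betaWeight c b h) s₀ - c) / 8) (by linarith)).and
    (eventually_ge_atTop s₀)).exists
  have := hmono hs₀ (hs₀.trans_le hle) hle
  linarith

end IsRegularWeight

/-! ### The lower bound `p` for the maximal risk -/

section Risk

variable {p : ℕ}

lemma lintegral_gaussDensity {v : ℝ} (hv : 0 < v) (μ : EuclideanSpace ℝ (Fin p)) :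
    ∫⁻ x, ENNReal.ofReal (gaussDensity v μ x) = 1 := by
  rw [← ofReal_integral_eq_lintegral_ofReal (integrable_gaussDensity hv μ)
    (Eventually.of_forall fun x => (gaussDensity_pos hv x).le), integral_gaussDensity hv,
    ENNReal.ofReal_one]

lemma lintegral_norm_sub_sq_mul_gaussDensity {v : ℝ} (hv : 0 < v)
    (μ d : EuclideanSpace ℝ (Fin p)) :
    ∫⁻ x, ENNReal.ofReal (‖x - d‖ ^ 2 * gaussDensity v μ x) =
      ENNReal.ofReal (p * v + ‖μ - d‖ ^ 2) := by
  rw [← ofReal_integral_eq_lintegral_ofReal (integrable_norm_sub_sq_mul_gaussDensity hv μ d)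
    (Eventually.of_forall fun x => mul_nonneg (sq_nonneg _) (gaussDensity_pos hv x).le),
    integral_norm_sub_sq_mul_gaussDensity hv]

/-- The joint density of parameter and observation under the normal prior `N_p(0, κ⁻¹(1-κ) I_p)`,
factored through the marginal law of the observation and the posterior law. -/
lemma normalDensity_mul_gaussDensity {κ : ℝ} (hκ : κ ∈ Ioo (0 : ℝ) 1)
    (β y : EuclideanSpace ℝ (Fin p)) :
    normalDensity β y * gaussDensity ((1 - κ) / κ) 0 β =
      gaussDensity (1 / κ) 0 y * gaussDensity (1 - κ) ((1 - κ) • y) β := by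
  have h0 := hκ.1
  have h1 : 0 < 1 - κ := sub_pos.2 hκ.2
  rw [normalDensity_eq_gaussDensity]
  simp only [gaussDensity]
  have e1 : (2 * Real.pi * 1) ^ (-((p : ℝ) / 2)) *
      (2 * Real.pi * ((1 - κ) / κ)) ^ (-((p : ℝ) / 2)) =
      (2 * Real.pi * (1 / κ)) ^ (-((p : ℝ) / 2)) * (2 * Real.pi * (1 - κ)) ^ (-((p : ℝ) / 2)) := by
    rw [← Real.mul_rpow (by positivity) (by positivity),
      ← Real.mul_rpow (by positivity) (by positivity)]
    congr 1
    field_simp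
  have e2 : -(‖y - β‖ ^ 2 / (2 * 1)) + -(‖β - 0‖ ^ 2 / (2 * ((1 - κ) / κ))) =
      -(‖y - 0‖ ^ 2 / (2 * (1 / κ))) + -(‖β - (1 - κ) • y‖ ^ 2 / (2 * (1 - κ))) := by
    rw [norm_sub_sq_real, norm_sub_sq_real β ((1 - κ) • y), inner_smul_right, norm_smul,
      real_inner_comm, Real.norm_of_nonneg h1.le, sub_zero, sub_zero]
    field_simp
    ring
  rw [mul_mul_mul_comm, ← Real.exp_add, e1, e2, Real.exp_add, mul_mul_mul_comm]

lemma measurable_normalDensity_uncurry :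
    Measurable fun q : EuclideanSpace ℝ (Fin p) × EuclideanSpace ℝ (Fin p) =>
      normalDensity q.1 q.2 := by
  unfold normalDensity; fun_prop

lemma measurable_normalDensity (β : EuclideanSpace ℝ (Fin p)) : Measurable (normalDensity β) := by
  unfold normalDensity; fun_prop

lemma normalDensity_pos (β y : EuclideanSpace ℝ (Fin p)) : 0 < normalDensity β y := by
  unfold normalDensity; positivity

lemma risk_eq_lintegral {δ : EuclideanSpace ℝ (Fin p) → EuclideanSpace ℝ (Fin p)}
    (hδ : Measurable δ) (β : EuclideanSpace ℝ (Fin p)) :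
    risk δ β = ∫⁻ y, ENNReal.ofReal (‖δ y - β‖ ^ 2 * normalDensity β y) := by
  rw [risk, normalLaw, lintegral_withDensity_eq_lintegral_mul _
    (measurable_normalDensity β).ennreal_ofReal (by fun_prop)]
  refine lintegral_congr fun y => ?_
  rw [Pi.mul_apply, ← ENNReal.ofReal_mul (normalDensity_pos β y).le, mul_comm]

/-- The maximal risk dominates the average risk under the proper prior `N_p(0, κ⁻¹(1-κ) I_p)`; after
exchanging integrals, each `y` contributes a posterior mean square error of at least the posterior
total variance `p(1-κ)`. -/
lemma ofReal_mul_one_sub_le_iSup_risk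
    {δ : EuclideanSpace ℝ (Fin p) → EuclideanSpace ℝ (Fin p)} (hδ : Measurable δ) {κ : ℝ}
    (hκ : κ ∈ Ioo (0 : ℝ) 1) : ENNReal.ofReal (p * (1 - κ)) ≤ ⨆ β, risk δ β := by
  have h0 := hκ.1
  have h1 : 0 < 1 - κ := sub_pos.2 hκ.2
  have hv : 0 < (1 - κ) / κ := by positivity
  have hv' : 0 < 1 / κ := by positivity
  calc ENNReal.ofReal (p * (1 - κ))
      = ∫⁻ y : EuclideanSpace ℝ (Fin p),
          ENNReal.ofReal (gaussDensity (1 / κ) 0 y) * ENNReal.ofReal (p * (1 - κ)) := by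
        rw [lintegral_mul_const _ (by fun_prop), lintegral_gaussDensity hv', one_mul]
    _ ≤ ∫⁻ y, ∫⁻ β, ENNReal.ofReal (‖δ y - β‖ ^ 2 * normalDensity β y) *
          ENNReal.ofReal (gaussDensity ((1 - κ) / κ) 0 β) := by
        refine lintegral_mono fun y => ?_
        have e : ∀ β, ENNReal.ofReal (‖δ y - β‖ ^ 2 * normalDensity β y) *
            ENNReal.ofReal (gaussDensity ((1 - κ) / κ) 0 β) =
            ENNReal.ofReal (gaussDensity (1 / κ) 0 y) *
              ENNReal.ofReal (‖β - δ y‖ ^ 2 * gaussDensity (1 - κ) ((1 - κ) • y) β) := fun β => by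
          rw [← ENNReal.ofReal_mul (mul_nonneg (sq_nonneg _) (normalDensity_pos β y).le),
            ← ENNReal.ofReal_mul (gaussDensity_pos hv' y).le, mul_assoc,
            normalDensity_mul_gaussDensity hκ, norm_sub_rev]
          congr 1
          ring
        simp_rw [e]
        rw [lintegral_const_mul _ (by fun_prop), lintegral_norm_sub_sq_mul_gaussDensity h1]
        gcongr
        exact le_add_of_nonneg_right (sq_nonneg _)
    _ = ∫⁻ β, ∫⁻ y, ENNReal.ofReal (‖δ y - β‖ ^ 2 * normalDensity β y) *
          ENNReal.ofReal (gaussDensity ((1 - κ) / κ) 0 β) := by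
        refine lintegral_lintegral_swap (Measurable.aemeasurable ?_)
        have m1 := (measurable_normalDensity_uncurry (p := p)).comp measurable_swap
        refine Measurable.mul (Measurable.ennreal_ofReal (Measurable.mul ?_ m1)) ?_
        · exact ((hδ.comp measurable_fst).sub measurable_snd).norm.pow_const 2
        · exact ((continuous_gaussDensity _ _).measurable.comp measurable_snd).ennreal_ofReal
    _ = ∫⁻ β, risk δ β * ENNReal.ofReal (gaussDensity ((1 - κ) / κ) 0 β) := by
        refine lintegral_congr fun β => ?_
        have := measurable_normalDensity β
        rw [lintegral_mul_const _ (by fun_prop), risk_eq_lintegral hδ]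
    _ ≤ ∫⁻ β, (⨆ β, risk δ β) *
          ENNReal.ofReal (gaussDensity ((1 - κ) / κ) (0 : EuclideanSpace ℝ (Fin p)) β) := by
        refine lintegral_mono fun β => ?_
        gcongr
        exact le_iSup (risk δ) β
    _ = ⨆ β, risk δ β := by
        rw [lintegral_const_mul _ (by fun_prop), lintegral_gaussDensity hv, mul_one]

/-- The minimax risk is at least `p`. -/
lemma ofReal_le_iSup_risk {δ : EuclideanSpace ℝ (Fin p) → EuclideanSpace ℝ (Fin p)}
    (hδ : Measurable δ) : ENNReal.ofReal p ≤ ⨆ β, risk δ β := by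
  have t : Tendsto (fun κ : ℝ => ENNReal.ofReal (p * (1 - κ))) (𝓝[>] 0)
      (𝓝 (ENNReal.ofReal (p * (1 - 0)))) :=
    ENNReal.tendsto_ofReal ((Continuous.tendsto (by fun_prop) 0).mono_left nhdsWithin_le_nhds)
  rw [sub_zero, mul_one] at t
  refine le_of_tendsto t ?_
  filter_upwards [Ioo_mem_nhdsGT (zero_lt_one (α := ℝ))] with κ hκ
  exact ofReal_mul_one_sub_le_iSup_risk hδ hκ

lemma isMinimax_of_risk_le {δ : EuclideanSpace ℝ (Fin p) → EuclideanSpace ℝ (Fin p)}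
    (hδ : Measurable δ) (hr : ∀ β, risk δ β ≤ ENNReal.ofReal p) : IsMinimax δ :=
  ⟨hδ, fun _ hδ' => (iSup_le hr).trans (ofReal_le_iSup_risk hδ')⟩

end Risk

/-! ### Stein's unbiased estimate of the risk -/

section Stein

variable {f : ℝ → ℝ}

/-- The ratio `M₁(s) / M₀(s)`, by which the estimator shrinks when `s = ‖y‖² / 2`. -/
noncomputable def shrinkFactor (f : ℝ → ℝ) (s : ℝ) : ℝ := tiltedMoment f 1 s / tiltedMoment f 0 s

/-- The derivative of `shrinkFactor`. -/
noncomputable def shrinkFactorDeriv (f : ℝ → ℝ) (s : ℝ) : ℝ :=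
  shrinkFactor f s ^ 2 - tiltedMoment f 2 s / tiltedMoment f 0 s

variable (hf : IntegrableOn f (Ioo 0 1)) (hpos : ∀ κ ∈ Ioo (0 : ℝ) 1, 0 < f κ)
include hf hpos

lemma shrinkFactor_mem (s : ℝ) : shrinkFactor f s ∈ Ioo (0 : ℝ) 1 := by
  have h0 := tiltedMoment_pos hf hpos 0 s
  have h1 := tiltedMoment_pos hf hpos 1 s
  exact ⟨div_pos h1 h0, (div_lt_one h0).2 (tiltedMoment_succ_lt hf hpos 0 s)⟩

/-- Provides the quadratic growth bound under which Stein's identity applies to the shrinkage term.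
-/
lemma abs_shrinkFactorDeriv_le (s : ℝ) : |shrinkFactorDeriv f s| ≤ 1 := by
  have h0 := tiltedMoment_pos hf hpos 0 s
  have h2 := tiltedMoment_pos hf hpos 2 s
  have h3 := (tiltedMoment_succ_lt hf hpos 1 s).trans (tiltedMoment_succ_lt hf hpos 0 s)
  obtain ⟨r0, r1⟩ := shrinkFactor_mem hf hpos s
  have q0 : 0 < tiltedMoment f 2 s / tiltedMoment f 0 s := div_pos h2 h0
  have q1 : tiltedMoment f 2 s / tiltedMoment f 0 s < 1 := (div_lt_one h0).2 h3
  unfold shrinkFactorDeriv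
  rw [abs_le]
  constructor <;> nlinarith

lemma hasDerivAt_shrinkFactor (s : ℝ) :
    HasDerivAt (shrinkFactor f) (shrinkFactorDeriv f s) s := by
  have h0 := tiltedMoment_pos hf hpos 0 s
  refine ((hasDerivAt_tiltedMoment hf 1 s).div (hasDerivAt_tiltedMoment hf 0 s)
    h0.ne').congr_deriv ?_
  unfold shrinkFactorDeriv shrinkFactor
  field_simp
  norm_num
  ring

lemma continuous_shrinkFactor : Continuous (shrinkFactor f) :=
  continuous_iff_continuousAt.2 fun s => (hasDerivAt_shrinkFactor hf hpos s).continuousAt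

lemma continuous_shrinkFactorDeriv : Continuous (shrinkFactorDeriv f) := by
  have hc : ∀ j, Continuous (tiltedMoment f j) := fun j =>
    continuous_iff_continuousAt.2 fun s => (hasDerivAt_tiltedMoment hf j s).continuousAt
  have := continuous_shrinkFactor hf hpos
  unfold shrinkFactorDeriv
  exact (this.pow 2).sub ((hc 2).div (hc 0) fun s => (tiltedMoment_pos hf hpos 0 s).ne')

variable {p : ℕ}

lemma hasLineDerivAt_shrink (y : EuclideanSpace ℝ (Fin p)) (i : Fin p) :
    HasLineDerivAt ℝ (fun y : EuclideanSpace ℝ (Fin p) => -(shrinkFactor f (‖y‖ ^ 2 / 2) * y i))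
      (-(shrinkFactorDeriv f (‖y‖ ^ 2 / 2) * y i ^ 2 + shrinkFactor f (‖y‖ ^ 2 / 2))) y
      (EuclideanSpace.single i (1 : ℝ)) := by
  unfold HasLineDerivAt
  simp only [norm_add_smul_single_sq]
  have d1 : HasDerivAt (fun t : ℝ => (‖y‖ ^ 2 + 2 * t * y i + t ^ 2) / 2) (y i) 0 := by
    refine ((((((hasDerivAt_id (0 : ℝ)).const_mul 2).mul_const (y i)).const_add
      (‖y‖ ^ 2)).add ((hasDerivAt_id (0 : ℝ)).pow 2)).div_const 2).congr_deriv ?_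
    simp
  have e0 : (‖y‖ ^ 2 + 2 * 0 * y i + 0 ^ 2) / 2 = ‖y‖ ^ 2 / 2 := by ring
  have d2 : HasDerivAt (fun t : ℝ => shrinkFactor f ((‖y‖ ^ 2 + 2 * t * y i + t ^ 2) / 2))
      (shrinkFactorDeriv f (‖y‖ ^ 2 / 2) * y i) 0 :=
    (hasDerivAt_shrinkFactor hf hpos _).comp_of_eq (0 : ℝ) d1 e0.symm
  have d3 : HasDerivAt (fun t : ℝ => (y + t • EuclideanSpace.single i (1 : ℝ)) i) 1 0 := by
    simpa using (hasDerivAt_id (0 : ℝ)).const_add (y i)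
  refine (d2.mul d3).neg.congr_deriv ?_
  simp [sq]
  ring

lemma measurable_shrinkEstimator :
    Measurable fun y : EuclideanSpace ℝ (Fin p) => (1 - shrinkFactor f (‖y‖ ^ 2 / 2)) • y := by
  have := continuous_shrinkFactor hf hpos
  fun_prop

/-- A sufficient condition for the risk of a shrinkage estimator to be at most `p`, from Stein's
unbiased estimate of the risk. -/
lemma risk_shrinkEstimator_le
    (hineq : ∀ s, 0 ≤ s → s * (2 * tiltedMoment f 2 s * tiltedMoment f 0 s -
      tiltedMoment f 1 s ^ 2) ≤ p * (tiltedMoment f 0 s * tiltedMoment f 1 s))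
    (β : EuclideanSpace ℝ (Fin p)) :
    risk (fun y : EuclideanSpace ℝ (Fin p) => (1 - shrinkFactor f (‖y‖ ^ 2 / 2)) • y) β ≤
      ENNReal.ofReal p := by
  have hr := continuous_shrinkFactor hf hpos
  have hr' := continuous_shrinkFactorDeriv hf hpos
  set G : Fin p → EuclideanSpace ℝ (Fin p) → ℝ :=
    fun i y => -(shrinkFactor f (‖y‖ ^ 2 / 2) * y i) with hG
  set G' : Fin p → EuclideanSpace ℝ (Fin p) → ℝ := fun i y =>
    -(shrinkFactorDeriv f (‖y‖ ^ 2 / 2) * y i ^ 2 + shrinkFactor f (‖y‖ ^ 2 / 2)) with hG'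
  have cG : ∀ i, Continuous (G i) := fun i => by rw [hG]; fun_prop
  have cG' : ∀ i, Continuous (G' i) := fun i => by rw [hG']; fun_prop
  have bG : ∀ i y, |G i y| ≤ ‖y‖ := fun i y => by
    obtain ⟨r0, r1⟩ := shrinkFactor_mem hf hpos (‖y‖ ^ 2 / 2)
    rw [hG, abs_neg, abs_mul, abs_of_pos r0]
    exact (mul_le_of_le_one_left (abs_nonneg _) r1.le).trans (abs_apply_le_norm y i)
  have bG' : ∀ i y, |G' i y| ≤ 1 + ‖y‖ ^ 2 := fun i y => by
    obtain ⟨r0, r1⟩ := shrinkFactor_mem hf hpos (‖y‖ ^ 2 / 2)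
    have h1 := abs_shrinkFactorDeriv_le hf hpos (‖y‖ ^ 2 / 2)
    have h2 : y i ^ 2 ≤ ‖y‖ ^ 2 := by
      rw [← sq_abs]; gcongr; exact abs_apply_le_norm y i
    rw [hG', abs_neg]
    refine (abs_add_le _ _).trans ?_
    rw [abs_mul, abs_of_pos r0, abs_of_nonneg (sq_nonneg (y i))]
    have h3 : |shrinkFactorDeriv f (‖y‖ ^ 2 / 2)| * y i ^ 2 ≤ 1 * ‖y‖ ^ 2 := by gcongr
    linarith
  have i1 := fun i => integrable_apply_sub_sq_mul_gaussDensity one_pos β β i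
  have i2 : ∀ i, Integrable fun y => (y i - β i) * G i y * gaussDensity 1 β y := fun i => by
    refine integrable_mul_gaussDensity one_pos β (C := 1 + ‖β‖) (by have := cG i; fun_prop)
      fun y => ?_
    rw [abs_mul]
    have e1 := abs_sub (y i) (β i)
    have e2 := abs_apply_le_norm y i
    have e3 := abs_apply_le_norm β i
    calc |y i - β i| * |G i y| ≤ (‖y‖ + ‖β‖) * ‖y‖ := by
          gcongr
          · linarith
          · exact bG i y
      _ ≤ _ := by nlinarith [norm_nonneg y, norm_nonneg β, sq_nonneg (‖y‖ - 1),
          mul_nonneg (norm_nonneg β) (sq_nonneg (‖y‖ - 1))]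
  have i3 : ∀ i, Integrable fun y => G i y ^ 2 * gaussDensity 1 β y := fun i => by
    refine integrable_mul_gaussDensity one_pos β (C := 1) ((cG i).pow 2) fun y => ?_
    rw [abs_pow, one_mul]
    have := pow_le_pow_left₀ (abs_nonneg _) (bG i y) 2
    linarith
  have i4 : ∀ i, Integrable fun y => G' i y * gaussDensity 1 β y := fun i =>
    integrable_mul_gaussDensity one_pos β (C := 1) (cG' i) fun y => by simpa using bG' i y
  have stein : ∀ i, ∫ y, (y i - β i) * G i y * gaussDensity 1 β y =
      ∫ y, G' i y * gaussDensity 1 β y := fun i => by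
    have := integral_sub_mul_gaussDensity one_pos β i (cG i) (cG' i)
      (fun y => hasLineDerivAt_shrink hf hpos y i) (C := 1)
      (fun y => by linarith [bG i y]) (fun y => by simpa using bG' i y)
    rwa [one_mul] at this
  rw [risk_eq_lintegral (measurable_shrinkEstimator hf hpos)]
  have expand : ∀ y : EuclideanSpace ℝ (Fin p),
      ‖(1 - shrinkFactor f (‖y‖ ^ 2 / 2)) • y - β‖ ^ 2 * normalDensity β y =
      ∑ i, ((y i - β i) ^ 2 * gaussDensity 1 β y +
        (2 * ((y i - β i) * G i y * gaussDensity 1 β y) + G i y ^ 2 * gaussDensity 1 β y)) := by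
    intro y
    rw [normalDensity_eq_gaussDensity, EuclideanSpace.real_norm_sq_eq, Finset.sum_mul]
    refine Finset.sum_congr rfl fun i _ => ?_
    simp only [hG, PiLp.sub_apply, PiLp.smul_apply, smul_eq_mul]
    ring
  have i23 : ∀ i, Integrable fun y => 2 * ((y i - β i) * G i y * gaussDensity 1 β y) +
      G i y ^ 2 * gaussDensity 1 β y := fun i => ((i2 i).const_mul 2).add (i3 i)
  have i123 : ∀ i, Integrable fun y => (y i - β i) ^ 2 * gaussDensity 1 β y +
      (2 * ((y i - β i) * G i y * gaussDensity 1 β y) + G i y ^ 2 * gaussDensity 1 β y) :=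
    fun i => (i1 i).add (i23 i)
  have i43 : ∀ i, Integrable fun y => 2 * (G' i y * gaussDensity 1 β y) +
      G i y ^ 2 * gaussDensity 1 β y := fun i => ((i4 i).const_mul 2).add (i3 i)
  simp_rw [expand]
  rw [← ofReal_integral_eq_lintegral_ofReal (integrable_finsetSum _ fun i _ => i123 i)]
  swap
  · refine Eventually.of_forall fun y => ?_
    beta_reduce
    rw [Pi.zero_apply, ← expand]
    exact mul_nonneg (sq_nonneg _) (normalDensity_pos β y).le
  refine ENNReal.ofReal_le_ofReal ?_
  rw [integral_finsetSum _ fun i _ => i123 i]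
  have term : ∀ i, ∫ y, ((y i - β i) ^ 2 * gaussDensity 1 β y +
      (2 * ((y i - β i) * G i y * gaussDensity 1 β y) + G i y ^ 2 * gaussDensity 1 β y)) =
      1 + ∫ y, (2 * (G' i y * gaussDensity 1 β y) + G i y ^ 2 * gaussDensity 1 β y) := by
    intro i
    rw [integral_add (i1 i) (i23 i), integral_add ((i2 i).const_mul 2) (i3 i),
      integral_add ((i4 i).const_mul 2) (i3 i), integral_const_mul, integral_const_mul, stein,
      integral_apply_sub_sq_mul_gaussDensity one_pos]
  simp_rw [term]
  rw [Finset.sum_add_distrib, ← integral_finsetSum _ fun i _ => i43 i]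
  have neg : ∫ y, ∑ i, (2 * (G' i y * gaussDensity 1 β y) + G i y ^ 2 * gaussDensity 1 β y) ≤ 0 := by
    refine integral_nonpos fun y => ?_
    have e : ∑ i, (2 * (G' i y * gaussDensity 1 β y) + G i y ^ 2 * gaussDensity 1 β y) =
        ((shrinkFactor f (‖y‖ ^ 2 / 2) ^ 2 - 2 * shrinkFactorDeriv f (‖y‖ ^ 2 / 2)) * ‖y‖ ^ 2 -
          2 * p * shrinkFactor f (‖y‖ ^ 2 / 2)) * gaussDensity 1 β y := by
      have e1 : ∀ i, 2 * (G' i y * gaussDensity 1 β y) + G i y ^ 2 * gaussDensity 1 β y =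
          ((shrinkFactor f (‖y‖ ^ 2 / 2) ^ 2 - 2 * shrinkFactorDeriv f (‖y‖ ^ 2 / 2)) * y i ^ 2 -
            2 * shrinkFactor f (‖y‖ ^ 2 / 2)) * gaussDensity 1 β y := fun i => by
        simp only [hG, hG']; ring
      simp_rw [e1]
      rw [← Finset.sum_mul, Finset.sum_sub_distrib, ← Finset.mul_sum,
        ← EuclideanSpace.real_norm_sq_eq, Finset.sum_const, Finset.card_univ, Fintype.card_fin,
        nsmul_eq_mul]
      ring
    rw [e]
    refine mul_nonpos_of_nonpos_of_nonneg ?_ (gaussDensity_pos one_pos y).le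
    set s := ‖y‖ ^ 2 / 2 with hs
    have h0 := tiltedMoment_pos hf hpos 0 s
    have hs0 : 0 ≤ s := by positivity
    -- The unbiased estimate of the risk difference, written through moments: `r' = r² - M₂/M₀`
    -- turns `r² - 2r'` into `(2M₂M₀ - M₁²)/M₀²`.
    have e2 : (shrinkFactor f s ^ 2 - 2 * shrinkFactorDeriv f s) * ‖y‖ ^ 2 -
        2 * p * shrinkFactor f s = 2 / tiltedMoment f 0 s ^ 2 *
        (s * (2 * tiltedMoment f 2 s * tiltedMoment f 0 s - tiltedMoment f 1 s ^ 2) -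
          p * (tiltedMoment f 0 s * tiltedMoment f 1 s)) := by
      rw [show ‖y‖ ^ 2 = 2 * s by rw [hs]; ring]
      unfold shrinkFactorDeriv shrinkFactor
      field_simp
      ring
    rw [e2]
    exact mul_nonpos_of_nonneg_of_nonpos (by positivity) (sub_nonpos.2 (hineq s hs0))
  simpa using neg

end Stein

/-! ### The posterior law and its mean -/

section GaussianMean

variable {p : ℕ} {v : ℝ}

lemma integrable_gaussDensity_smul (hv : 0 < v) (μ : EuclideanSpace ℝ (Fin p)) :
    Integrable fun x => gaussDensity v μ x • x := by
  refine (integrable_mul_gaussDensity hv μ (g := fun x => ‖x‖) (C := 1) (by fun_prop)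
    fun x => ?_).mono' (by fun_prop) (Eventually.of_forall fun x => ?_)
  · rw [abs_norm]
    nlinarith [sq_nonneg (‖x‖ - 1), sq_nonneg ‖x‖]
  · rw [norm_smul, Real.norm_of_nonneg (gaussDensity_pos hv x).le, mul_comm]

lemma integral_gaussDensity_smul (hv : 0 < v) (μ : EuclideanSpace ℝ (Fin p)) :
    ∫ x, gaussDensity v μ x • x = μ := by
  have h0 : ∫ x : EuclideanSpace ℝ (Fin p), gaussDensity v 0 x • x = 0 := by
    have h1 := integral_neg_eq_self
      (fun x : EuclideanSpace ℝ (Fin p) => gaussDensity v 0 x • x) volume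
    have h2 : ∀ x : EuclideanSpace ℝ (Fin p), gaussDensity v 0 (-x) • (-x) =
        -(gaussDensity v 0 x • x) := fun x => by simp [gaussDensity]
    simp_rw [h2] at h1
    rw [integral_neg] at h1
    have h3 : (2 : ℝ) • ∫ x : EuclideanSpace ℝ (Fin p), gaussDensity v 0 x • x = 0 := by
      rw [two_smul]
      nth_rw 1 [← h1]
      exact neg_add_cancel _
    simpa using h3
  rw [← integral_add_right_eq_self _ μ]
  have h3 : ∀ x : EuclideanSpace ℝ (Fin p), gaussDensity v μ (x + μ) • (x + μ) =
      gaussDensity v 0 x • x + gaussDensity v 0 x • μ := fun x => by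
    rw [← smul_add]; simp [gaussDensity]
  simp_rw [h3]
  rw [integral_add (integrable_gaussDensity_smul hv 0)
    ((integrable_gaussDensity hv 0).smul_const μ), h0, integral_smul_const,
    integral_gaussDensity hv, one_smul, zero_add]

lemma lintegral_enorm_mul_gaussDensity_le (hv : 0 < v) (μ : EuclideanSpace ℝ (Fin p)) :
    ∫⁻ x, ENNReal.ofReal (‖x‖ * gaussDensity v μ x) ≤ ENNReal.ofReal (1 + p * v + ‖μ‖ ^ 2) := by
  have i1 := integrable_gaussDensity hv μ
  have i2 := integrable_norm_sub_sq_mul_gaussDensity hv μ 0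
  have i12 : Integrable fun x => gaussDensity v μ x + ‖x - 0‖ ^ 2 * gaussDensity v μ x := i1.add i2
  have hn : ∀ x, 0 ≤ gaussDensity v μ x + ‖x - 0‖ ^ 2 * gaussDensity v μ x := fun x =>
    add_nonneg (gaussDensity_pos hv x).le (mul_nonneg (sq_nonneg _) (gaussDensity_pos hv x).le)
  calc ∫⁻ x, ENNReal.ofReal (‖x‖ * gaussDensity v μ x)
      ≤ ∫⁻ x, ENNReal.ofReal (gaussDensity v μ x + ‖x - 0‖ ^ 2 * gaussDensity v μ x) := by
        refine lintegral_mono fun x => ENNReal.ofReal_le_ofReal ?_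
        rw [sub_zero]
        nlinarith [gaussDensity_pos (μ := μ) hv x, mul_nonneg (gaussDensity_pos (μ := μ) hv x).le
          (sq_nonneg (‖x‖ - 1)), mul_nonneg (gaussDensity_pos (μ := μ) hv x).le (sq_nonneg ‖x‖)]
    _ = ENNReal.ofReal (1 + p * v + ‖μ‖ ^ 2) := by
        rw [← ofReal_integral_eq_lintegral_ofReal i12 (Eventually.of_forall hn),
          integral_add i1 i2, integral_gaussDensity hv, integral_norm_sub_sq_mul_gaussDensity hv,
          sub_zero, add_assoc]

end GaussianMean

section Posterior

variable {p : ℕ} {a b : ℝ} {h : ℝ → ℝ}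

/-- The joint density of `(β, κ)` and the observation `y`, factored through the conditional law
of `β` given `κ` and `y`. -/
noncomputable def jointDensity (a b : ℝ) (h : ℝ → ℝ) (y : EuclideanSpace ℝ (Fin p))
    (q : EuclideanSpace ℝ (Fin p) × ℝ) : ℝ :=
  (2 * Real.pi) ^ (-((p : ℝ) / 2)) *
    tilted (betaWeight ((p : ℝ) / 2 + a) b h) 0 (‖y‖ ^ 2 / 2) q.2 *
      gaussDensity (1 - q.2) ((1 - q.2) • y) q.1

lemma measurable_jointDensity (hm : Measurable h) (y : EuclideanSpace ℝ (Fin p)) :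
    Measurable (jointDensity a b h y) := by
  unfold jointDensity tilted betaWeight gaussDensity
  fun_prop

lemma tilted_betaWeight_pos (hpos : ∀ κ ∈ Ioo (0 : ℝ) 1, 0 < h κ) (c s : ℝ) {κ : ℝ}
    (hκ : κ ∈ Ioo (0 : ℝ) 1) : 0 < tilted (betaWeight c b h) 0 s κ := by
  have h0 := hκ.1
  have h1 : 0 < 1 - κ := sub_pos.2 hκ.2
  have h2 := hpos κ hκ
  unfold tilted betaWeight
  positivity

lemma jointDensity_nonneg (hpos : ∀ κ ∈ Ioo (0 : ℝ) 1, 0 < h κ) (y β : EuclideanSpace ℝ (Fin p))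
    {κ : ℝ} (hκ : κ ∈ Ioo (0 : ℝ) 1) : 0 ≤ jointDensity a b h y (β, κ) :=
  mul_nonneg (mul_nonneg (by positivity) (tilted_betaWeight_pos hpos _ _ hκ).le)
    (gaussDensity_pos (sub_pos.2 hκ.2) _).le

/-- The marginal normal law of `y` given `κ` contributes `κ^(p/2) e^(-κ‖y‖²/2)`, which shifts the
exponent `a` to `p/2 + a` and tilts by `s = ‖y‖²/2`. -/
lemma normalDensity_mul_prior (y β : EuclideanSpace ℝ (Fin p)) {κ : ℝ}
    (hκ : κ ∈ Ioo (0 : ℝ) 1) :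
    normalDensity β y * ((2 * Real.pi) ^ (-((p : ℝ) / 2)) * (κ / (1 - κ)) ^ ((p : ℝ) / 2) *
      Real.exp (-(κ / (1 - κ) * (‖β‖ ^ 2 / 2))) * priorKappa a b h κ) =
      jointDensity a b h y (β, κ) := by
  have h0 := hκ.1
  have h1 : 0 < 1 - κ := sub_pos.2 hκ.2
  have e1 : (2 * Real.pi) ^ (-((p : ℝ) / 2)) * (κ / (1 - κ)) ^ ((p : ℝ) / 2) *
      Real.exp (-(κ / (1 - κ) * (‖β‖ ^ 2 / 2))) = gaussDensity ((1 - κ) / κ) 0 β := by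
    rw [gaussDensity, Real.mul_rpow (x := 2 * Real.pi) (y := (1 - κ) / κ) (by positivity)
      (by positivity), ← inv_div (1 - κ) κ, Real.inv_rpow (by positivity),
      ← Real.rpow_neg (by positivity), sub_zero]
    congr 3
    field_simp
  have e2 : gaussDensity (1 / κ) 0 y * priorKappa a b h κ = (2 * Real.pi) ^ (-((p : ℝ) / 2)) *
      tilted (betaWeight ((p : ℝ) / 2 + a) b h) 0 (‖y‖ ^ 2 / 2) κ := by
    have e3 : κ ^ ((p : ℝ) / 2 + a - 1) = κ ^ ((p : ℝ) / 2) * κ ^ (a - 1) := by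
      rw [← Real.rpow_add h0]; ring_nf
    rw [gaussDensity, Real.mul_rpow (by positivity) (by positivity), one_div,
      Real.inv_rpow h0.le, ← Real.rpow_neg h0.le, neg_neg, tilted, betaWeight, e3, priorKappa,
      sub_zero, show ‖y‖ ^ 2 / (2 * κ⁻¹) = ‖y‖ ^ 2 / 2 * κ by field_simp]
    ring
  rw [e1, ← mul_assoc, normalDensity_mul_gaussDensity hκ, jointDensity, ← e2]
  ring

lemma normalDensity_mul_priorBeta (hm : Measurable h) (y β : EuclideanSpace ℝ (Fin p)) :
    ENNReal.ofReal (normalDensity β y) * priorBeta a b h β =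
      ∫⁻ κ in Ioo (0 : ℝ) 1, ENNReal.ofReal (jointDensity a b h y (β, κ)) := by
  rw [priorBeta, ← lintegral_const_mul _ (by unfold priorKappa; fun_prop)]
  refine setLIntegral_congr_fun measurableSet_Ioo fun κ hκ => ?_
  rw [← ENNReal.ofReal_mul (normalDensity_pos β y).le, normalDensity_mul_prior y β hκ]

lemma measurable_posteriorDensity (hm : Measurable h) (y : EuclideanSpace ℝ (Fin p)) :
    Measurable fun β => ENNReal.ofReal (normalDensity β y) * priorBeta a b h β := by
  simp_rw [normalDensity_mul_priorBeta hm]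
  exact (measurable_jointDensity hm y).ennreal_ofReal.lintegral_prod_right'

lemma lintegral_mul_jointDensity (y : EuclideanSpace ℝ (Fin p))
    (hpos : ∀ κ ∈ Ioo (0 : ℝ) 1, 0 < h κ) {g : EuclideanSpace ℝ (Fin p) → ℝ}
    (hg : Measurable g) {κ : ℝ} (hκ : κ ∈ Ioo (0 : ℝ) 1) :
    ∫⁻ β, ENNReal.ofReal (g β * jointDensity a b h y (β, κ)) =
      ENNReal.ofReal ((2 * Real.pi) ^ (-((p : ℝ) / 2)) *
        tilted (betaWeight ((p : ℝ) / 2 + a) b h) 0 (‖y‖ ^ 2 / 2) κ) *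
      ∫⁻ β, ENNReal.ofReal (g β * gaussDensity (1 - κ) ((1 - κ) • y) β) := by
  rw [← lintegral_const_mul _ (by fun_prop)]
  refine lintegral_congr fun β => ?_
  rw [← ENNReal.ofReal_mul (mul_nonneg (by positivity) (tilted_betaWeight_pos hpos _ _ hκ).le),
    jointDensity]
  congr 1
  ring

lemma lintegral_tilted (hint : IntegrableOn (betaWeight ((p : ℝ) / 2 + a) b h) (Ioo 0 1))
    (hpos : ∀ κ ∈ Ioo (0 : ℝ) 1, 0 < h κ) (s : ℝ) :
    ∫⁻ κ in Ioo (0 : ℝ) 1, ENNReal.ofReal ((2 * Real.pi) ^ (-((p : ℝ) / 2)) *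
        tilted (betaWeight ((p : ℝ) / 2 + a) b h) 0 s κ) =
      ENNReal.ofReal ((2 * Real.pi) ^ (-((p : ℝ) / 2)) *
        tiltedMoment (betaWeight ((p : ℝ) / 2 + a) b h) 0 s) := by
  have i1 : IntegrableOn (fun κ => (2 * Real.pi) ^ (-((p : ℝ) / 2)) *
      tilted (betaWeight ((p : ℝ) / 2 + a) b h) 0 s κ) (Ioo 0 1) :=
    (integrableOn_tilted hint 0 s).const_mul _
  rw [← ofReal_integral_eq_lintegral_ofReal i1, integral_const_mul]
  · rfl
  · exact (ae_restrict_iff' measurableSet_Ioo).2 (Eventually.of_forall fun κ hκ =>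
      mul_nonneg (by positivity) (tilted_betaWeight_pos hpos _ _ hκ).le)

lemma marginal_eq_of_measurable (hm : Measurable h) (hpos : ∀ κ ∈ Ioo (0 : ℝ) 1, 0 < h κ)
    (hint : IntegrableOn (betaWeight ((p : ℝ) / 2 + a) b h) (Ioo 0 1))
    (y : EuclideanSpace ℝ (Fin p)) :
    marginal a b h y = ENNReal.ofReal ((2 * Real.pi) ^ (-((p : ℝ) / 2)) *
      tiltedMoment (betaWeight ((p : ℝ) / 2 + a) b h) 0 (‖y‖ ^ 2 / 2)) := by
  unfold marginal
  simp_rw [normalDensity_mul_priorBeta hm]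
  rw [lintegral_lintegral_swap (measurable_jointDensity hm y).ennreal_ofReal.aemeasurable,
    ← lintegral_tilted hint hpos]
  refine setLIntegral_congr_fun measurableSet_Ioo fun κ hκ => ?_
  have := lintegral_mul_jointDensity (a := a) (b := b) y hpos (g := fun _ => 1)
    measurable_const hκ
  simp only [one_mul, lintegral_gaussDensity (sub_pos.2 hκ.2), mul_one] at this
  exact this

/-- Justifies Fubini: given `κ`, the mean of `‖β‖` is at most `1 + p + ‖y‖²`, uniformly in `κ`, and
the remaining weight is integrable. -/
lemma integrable_jointDensity_smul (hm : Measurable h) (hpos : ∀ κ ∈ Ioo (0 : ℝ) 1, 0 < h κ)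
    (hint : IntegrableOn (betaWeight ((p : ℝ) / 2 + a) b h) (Ioo 0 1))
    (y : EuclideanSpace ℝ (Fin p)) :
    Integrable (fun q : EuclideanSpace ℝ (Fin p) × ℝ => jointDensity a b h y q • q.1)
      (volume.prod (volume.restrict (Ioo 0 1))) := by
  have hJ := measurable_jointDensity (a := a) (b := b) hm y
  have hJm : Measurable fun q : EuclideanSpace ℝ (Fin p) × ℝ => jointDensity a b h y q • q.1 :=
    hJ.smul measurable_fst
  refine ⟨hJm.aestronglyMeasurable, ?_⟩
  rw [HasFiniteIntegral, lintegral_prod_symm' _ hJm.enorm]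
  have hle : ∀ κ ∈ Ioo (0 : ℝ) 1, ∫⁻ β, ‖jointDensity a b h y (β, κ) • β‖ₑ ≤
      ENNReal.ofReal ((2 * Real.pi) ^ (-((p : ℝ) / 2)) *
        tilted (betaWeight ((p : ℝ) / 2 + a) b h) 0 (‖y‖ ^ 2 / 2) κ) *
      ENNReal.ofReal (1 + p + ‖y‖ ^ 2) := by
    intro κ hκ
    have h1 : 0 < 1 - κ := sub_pos.2 hκ.2
    have e : ∀ β : EuclideanSpace ℝ (Fin p), ‖jointDensity a b h y (β, κ) • β‖ₑ =
        ENNReal.ofReal (‖β‖ * jointDensity a b h y (β, κ)) := fun β => by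
      rw [← ofReal_norm, norm_smul,
        Real.norm_of_nonneg (jointDensity_nonneg hpos y β hκ), mul_comm]
    simp_rw [e]
    rw [lintegral_mul_jointDensity y hpos measurable_norm hκ]
    gcongr
    refine (lintegral_enorm_mul_gaussDensity_le h1 _).trans (ENNReal.ofReal_le_ofReal ?_)
    rw [norm_smul, Real.norm_of_nonneg h1.le, mul_pow]
    have e1 : (1 - κ) ^ 2 ≤ 1 := pow_le_one₀ h1.le (by linarith [hκ.1])
    have e2 : (p : ℝ) * (1 - κ) ≤ p * 1 := by gcongr; linarith [hκ.1]
    have e3 : (1 - κ) ^ 2 * ‖y‖ ^ 2 ≤ 1 * ‖y‖ ^ 2 := by gcongr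
    linarith
  refine (setLIntegral_mono' measurableSet_Ioo hle).trans_lt ?_
  rw [lintegral_mul_const' _ _ ENNReal.ofReal_ne_top, lintegral_tilted hint hpos]
  exact ENNReal.mul_lt_top ENNReal.ofReal_lt_top ENNReal.ofReal_lt_top

lemma toReal_posteriorDensity_smul (hm : Measurable h) (hpos : ∀ κ ∈ Ioo (0 : ℝ) 1, 0 < h κ)
    (y β : EuclideanSpace ℝ (Fin p)) :
    (ENNReal.ofReal (normalDensity β y) * priorBeta a b h β).toReal • β =
      ∫ κ in Ioo (0 : ℝ) 1, jointDensity a b h y (β, κ) • β := by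
  rw [normalDensity_mul_priorBeta hm, integral_smul_const, integral_eq_lintegral_of_nonneg_ae]
  · exact (ae_restrict_iff' measurableSet_Ioo).2
      (Eventually.of_forall fun κ hκ => jointDensity_nonneg hpos y β hκ)
  · exact ((measurable_jointDensity hm y).comp measurable_prodMk_left).aestronglyMeasurable

lemma integrable_posteriorDensity_smul (hm : Measurable h)
    (hpos : ∀ κ ∈ Ioo (0 : ℝ) 1, 0 < h κ)
    (hint : IntegrableOn (betaWeight ((p : ℝ) / 2 + a) b h) (Ioo 0 1))
    (y : EuclideanSpace ℝ (Fin p)) :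
    Integrable fun β : EuclideanSpace ℝ (Fin p) =>
      (ENNReal.ofReal (normalDensity β y) * priorBeta a b h β).toReal • β := by
  simp_rw [toReal_posteriorDensity_smul hm hpos]
  exact (integrable_jointDensity_smul hm hpos hint y).integral_prod_left

/-- Integrating over `β` first leaves the conditional mean `(1-κ) y`, whose factor `1 - κ` yields
`M₀ - M₁`. -/
lemma integral_posteriorDensity_smul (hm : Measurable h)
    (hpos : ∀ κ ∈ Ioo (0 : ℝ) 1, 0 < h κ)
    (hint : IntegrableOn (betaWeight ((p : ℝ) / 2 + a) b h) (Ioo 0 1))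
    (y : EuclideanSpace ℝ (Fin p)) :
    ∫ β : EuclideanSpace ℝ (Fin p),
      (ENNReal.ofReal (normalDensity β y) * priorBeta a b h β).toReal • β =
    ((2 * Real.pi) ^ (-((p : ℝ) / 2)) *
      (tiltedMoment (betaWeight ((p : ℝ) / 2 + a) b h) 0 (‖y‖ ^ 2 / 2) -
        tiltedMoment (betaWeight ((p : ℝ) / 2 + a) b h) 1 (‖y‖ ^ 2 / 2))) • y := by
  simp_rw [toReal_posteriorDensity_smul hm hpos]
  rw [integral_integral_swap (integrable_jointDensity_smul hm hpos hint y)]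
  set s := ‖y‖ ^ 2 / 2
  have e : ∀ κ ∈ Ioo (0 : ℝ) 1, ∫ β, jointDensity a b h y (β, κ) • β =
      ((2 * Real.pi) ^ (-((p : ℝ) / 2)) * (tilted (betaWeight ((p : ℝ) / 2 + a) b h) 0 s κ -
        tilted (betaWeight ((p : ℝ) / 2 + a) b h) 1 s κ)) • y := by
    intro κ hκ
    simp only [jointDensity, mul_smul]
    rw [integral_smul, integral_smul, integral_gaussDensity_smul (sub_pos.2 hκ.2),
      tilted_succ]
    simp only [smul_smul]
    congr 1
    ring
  rw [setIntegral_congr_fun measurableSet_Ioo e, integral_smul_const, integral_const_mul,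
    integral_sub (integrableOn_tilted hint 0 s) (integrableOn_tilted hint 1 s)]
  rfl

end Posterior

/-! ### The Bayes estimator as a shrinkage estimator -/

section Bayes

variable {p : ℕ} {a b : ℝ} {h : ℝ → ℝ}

lemma bayes_of_measurable (hm : Measurable h) (hpos : ∀ κ ∈ Ioo (0 : ℝ) 1, 0 < h κ)
    (hint : IntegrableOn (betaWeight ((p : ℝ) / 2 + a) b h) (Ioo 0 1)) :
    BayesWellDefined p a b h ∧ ∀ y, bayesEstimator p a b h y =
      (1 - shrinkFactor (betaWeight ((p : ℝ) / 2 + a) b h) (‖y‖ ^ 2 / 2)) • y := by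
  have hfpos : ∀ κ ∈ Ioo (0 : ℝ) 1, 0 < betaWeight ((p : ℝ) / 2 + a) b h κ := fun κ hκ =>
    mul_pos (mul_pos (Real.rpow_pos_of_pos hκ.1 _) (Real.rpow_pos_of_pos (sub_pos.2 hκ.2) _))
      (hpos κ hκ)
  have hM := fun s => tiltedMoment_pos hint hfpos 0 s
  have hA : 0 < (2 * Real.pi) ^ (-((p : ℝ) / 2)) := by positivity
  have hmarg := fun y => marginal_eq_of_measurable hm hpos hint (p := p) y
  have hfin : ∀ y : EuclideanSpace ℝ (Fin p),
      ∀ᵐ β, ENNReal.ofReal (normalDensity β y) * priorBeta a b h β < ∞ := fun y => by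
    refine ae_lt_top (measurable_posteriorDensity hm y) ?_
    have := hmarg y
    unfold marginal at this
    rw [this]
    exact ENNReal.ofReal_ne_top
  have hne : ∀ y : EuclideanSpace ℝ (Fin p), marginal a b h y ≠ 0 := fun y => by
    rw [hmarg, ne_eq, ENNReal.ofReal_eq_zero, not_le]
    exact mul_pos hA (hM _)
  refine ⟨fun y => ⟨hne y, ?_, ?_⟩, fun y => ?_⟩
  · rw [hmarg]; exact ENNReal.ofReal_ne_top
  · refine Integrable.smul_measure ?_ (ENNReal.inv_ne_top.2 (hne y))
    rw [integrable_withDensity_iff_integrable_smul' (measurable_posteriorDensity hm y) (hfin y)]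
    exact integrable_posteriorDensity_smul hm hpos hint y
  · rw [bayesEstimator, posterior, integral_smul_measure,
      integral_withDensity_eq_integral_toReal_smul (measurable_posteriorDensity hm y) (hfin y),
      integral_posteriorDensity_smul hm hpos hint, hmarg, smul_smul, ENNReal.toReal_inv,
      ENNReal.toReal_ofReal (mul_pos hA (hM _)).le, shrinkFactor]
    congr 1
    have := hM (‖y‖ ^ 2 / 2)
    generalize tiltedMoment (betaWeight ((p : ℝ) / 2 + a) b h) 0 (‖y‖ ^ 2 / 2) = m₀ at this ⊢
    field_simp

lemma priorBeta_congr {h₁ h₂ : ℝ → ℝ} (heq : EqOn h₁ h₂ (Ioo 0 1)) :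
    priorBeta (p := p) a b h₁ = priorBeta a b h₂ := by
  ext β
  refine setLIntegral_congr_fun measurableSet_Ioo fun κ hκ => ?_
  simp only [priorKappa, heq hκ]

lemma posterior_congr {h₁ h₂ : ℝ → ℝ} (heq : EqOn h₁ h₂ (Ioo 0 1)) :
    marginal (p := p) a b h₁ = marginal a b h₂ ∧ posterior (p := p) a b h₁ = posterior a b h₂ := by
  have h1 : marginal (p := p) a b h₁ = marginal a b h₂ := by
    unfold marginal; rw [priorBeta_congr heq]
  refine ⟨h1, ?_⟩
  unfold posterior
  rw [h1, priorBeta_congr heq]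

/-- The generalized Bayes estimator is a well-defined shrinkage estimator. -/
lemma bayes_eq (hcont : ContinuousOn h (Ioo 0 1)) (hpos : ∀ κ ∈ Ioo (0 : ℝ) 1, 0 < h κ)
    (hint : IntegrableOn (betaWeight ((p : ℝ) / 2 + a) b h) (Ioo 0 1)) :
    BayesWellDefined p a b h ∧ ∀ y, bayesEstimator p a b h y =
      (1 - shrinkFactor (betaWeight ((p : ℝ) / 2 + a) b h) (‖y‖ ^ 2 / 2)) • y := by
  -- Only the values of `h` on `(0, 1)` enter the integrals, so `h` is replaced by a globally
  -- measurable function agreeing with it there.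
  set h' := (Ioo (0 : ℝ) 1).indicator h with hh'
  have heq : EqOn h' h (Ioo 0 1) := fun κ hκ => indicator_of_mem hκ h
  have hm : Measurable h' := by
    classical
    rw [hh', ← piecewise_eq_indicator]
    exact hcont.measurable_piecewise continuousOn_const measurableSet_Ioo
  have hw : EqOn (betaWeight ((p : ℝ) / 2 + a) b h') (betaWeight ((p : ℝ) / 2 + a) b h)
      (Ioo 0 1) := fun κ hκ => by simp only [betaWeight, heq hκ]
  have hmom : ∀ j s, tiltedMoment (betaWeight ((p : ℝ) / 2 + a) b h') j s =
      tiltedMoment (betaWeight ((p : ℝ) / 2 + a) b h) j s := fun j s =>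
    setIntegral_congr_fun measurableSet_Ioo fun κ hκ => by
      simp only [tilted, hw hκ]
  have key := bayes_of_measurable (p := p) (a := a) (b := b) hm
    (fun κ hκ => by rw [heq hκ]; exact hpos κ hκ)
    ((integrableOn_congr_fun hw measurableSet_Ioo).2 hint)
  obtain ⟨e1, e2⟩ := posterior_congr (p := p) (a := a) (b := b) heq
  simpa only [BayesWellDefined, bayesEstimator, e1, e2, shrinkFactor, hmom] using key

lemma shrinkage_eq (w : ℝ) : shrinkage p a b h w =
    w * shrinkFactor (betaWeight ((p : ℝ) / 2 + a) b h) (w / 2) := by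
  unfold shrinkage shrinkFactor tiltedMoment
  congr 2
  · refine setIntegral_congr_fun measurableSet_Ioo fun κ hκ => ?_
    have e : κ ^ ((p : ℝ) / 2 + a - 1) = κ ^ ((p : ℝ) / 2) * κ ^ (a - 1) := by
      rw [← Real.rpow_add hκ.1]; ring_nf
    simp only [priorKappa, tilted, betaWeight, e, Real.rpow_add_one hκ.1.ne',
      show w / 2 * κ = κ * w / 2 by ring]
    ring
  · refine setIntegral_congr_fun measurableSet_Ioo fun κ hκ => ?_
    have e : κ ^ ((p : ℝ) / 2 + a - 1) = κ ^ ((p : ℝ) / 2) * κ ^ (a - 1) := by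
      rw [← Real.rpow_add hκ.1]; ring_nf
    simp only [priorKappa, tilted, betaWeight, e, show w / 2 * κ = κ * w / 2 by ring]
    ring

end Bayes

variable {p : ℕ} {a b : ℝ} {h : ℝ → ℝ}

/-- A differential inequality for the moments of the tilted weight makes the generalized Bayes
estimator well defined and minimax. -/
lemma IsRegularWeight.bayes_isMinimax (w : IsRegularWeight ((p : ℝ) / 2 + a) b h)
    (hineq : ∀ s, 0 ≤ s →
      s * (2 * tiltedMoment (betaWeight ((p : ℝ) / 2 + a) b h) 2 s *
        tiltedMoment (betaWeight ((p : ℝ) / 2 + a) b h) 0 s -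
          tiltedMoment (betaWeight ((p : ℝ) / 2 + a) b h) 1 s ^ 2) ≤
      p * (tiltedMoment (betaWeight ((p : ℝ) / 2 + a) b h) 0 s *
        tiltedMoment (betaWeight ((p : ℝ) / 2 + a) b h) 1 s)) :
    BayesWellDefined p a b h ∧ IsMinimax (bayesEstimator p a b h) := by
  obtain ⟨h1, h2⟩ := bayes_eq (p := p) (a := a) (b := b)
    (fun κ hκ => (w.hasDerivAt κ hκ).continuousAt.continuousWithinAt) w.pos w.integrableOn
  refine ⟨h1, ?_⟩
  rw [funext h2]
  exact isMinimax_of_risk_le (measurable_shrinkEstimator w.integrableOn w.betaWeight_pos)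
    (risk_shrinkEstimator_le w.integrableOn w.betaWeight_pos hineq)

lemma IsRegularWeight.bayesEstimator_eq (w : IsRegularWeight ((p : ℝ) / 2 + a) b h)
    {y : EuclideanSpace ℝ (Fin p)} (hy : y ≠ 0) :
    bayesEstimator p a b h y = (1 - shrinkage p a b h (‖y‖ ^ 2) / ‖y‖ ^ 2) • y := by
  have h2 := (bayes_eq (p := p) (a := a) (b := b)
    (fun κ hκ => (w.hasDerivAt κ hκ).continuousAt.continuousWithinAt) w.pos w.integrableOn).2
  have : ‖y‖ ^ 2 ≠ 0 := pow_ne_zero 2 (norm_ne_zero_iff.2 hy)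
  rw [h2, shrinkage_eq, mul_div_cancel_left₀ _ this]

lemma momentRatio_eq_half_shrinkage (s : ℝ) :
    momentRatio (betaWeight ((p : ℝ) / 2 + a) b h) s = shrinkage p a b h (2 * s) / 2 := by
  rw [shrinkage_eq, mul_div_cancel_left₀ s two_ne_zero, momentRatio, shrinkFactor]
  ring

end ShrinkagePrior

/-! ### The two monotonicity cases -/

open ShrinkagePrior in
theorem mainTheorem2 (p : ℕ) (a b : ℝ) (h : ℝ → ℝ)
    (hh : ShrinkagePrior.IsAdmissible h)
    (ha₀ : -((p : ℝ) / 2) ≤ a) (ha₁ : a < (p : ℝ) / 2 - 2)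
    (hfin : a = -((p : ℝ) / 2) → IntegrableOn (fun κ : ℝ => κ⁻¹ * h κ) (Ioo 0 1)) :
    (AntitoneOn (ShrinkagePrior.H h) (Ioc 0 1) →
      -((p : ℝ) / 2 + a + 2) ≤ ShrinkagePrior.H h 1 →
      ((p : ℝ) + 2 * a + 2) / (3 * (p : ℝ) / 2 + a) ≤ b → b < 1 →
        ShrinkagePrior.BayesWellDefined p a b h ∧
        ShrinkagePrior.IsMinimax (ShrinkagePrior.bayesEstimator p a b h)) ∧
    (MonotoneOn (ShrinkagePrior.H h) (Ioc 0 1) →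
      ShrinkagePrior.H h 1 < ((p : ℝ) / 2 - a - 2) / 2 →
      ((p : ℝ) + 2 * a + 2 + 2 * ShrinkagePrior.H h 1) / (3 * (p : ℝ) / 2 + a) ≤ b → b < 1 →
        ShrinkagePrior.BayesWellDefined p a b h ∧
        ShrinkagePrior.IsMinimax (ShrinkagePrior.bayesEstimator p a b h) ∧
        (∀ y : EuclideanSpace ℝ (Fin p), y ≠ 0 →
          ShrinkagePrior.bayesEstimator p a b h y =
            (1 - ShrinkagePrior.shrinkage p a b h (‖y‖ ^ 2) / ‖y‖ ^ 2) • y) ∧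
        ¬ MonotoneOn (ShrinkagePrior.shrinkage p a b h) (Ioi 0) ∧
        ¬ AntitoneOn (ShrinkagePrior.shrinkage p a b h) (Ioi 0) ∧
        ¬ ShrinkagePrior.BaranchikCondition p (ShrinkagePrior.shrinkage p a b h)) := by
  have hc : 0 ≤ (p : ℝ) / 2 + a := by linarith
  have hden : 0 < 3 * (p : ℝ) / 2 + a := by linarith
  have hfin' : (p : ℝ) / 2 + a = 0 → IntegrableOn (fun κ : ℝ => κ⁻¹ * h κ) (Ioo 0 1) :=
    fun h0 => hfin (by linarith)
  have h1 : (1 : ℝ) ∈ Ioc (0 : ℝ) 1 := ⟨one_pos, le_rfl⟩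
  have hsub : Ioo (0 : ℝ) 1 ⊆ Ioc 0 1 := Ioo_subset_Ioc_self
  constructor
  · intro hanti hH1 hb hb1
    have hb0 : 0 < b := lt_of_lt_of_le (div_pos (by linarith) hden) hb
    have w := hh.isRegularWeight_of_antitoneOn hanti hc hb0 hb1 hfin'
    -- With `c = p/2 + a` the denominator is `p + c`, so `hb` becomes `2(c+1) ≤ b(p+c)`, the
    -- condition of the moment inequality at `P = p`.
    rw [div_le_iff₀ hden] at hb
    exact w.bayes_isMinimax fun s hs => w.tiltedMoment_ineq_of_antitoneOn (hanti.mono hsub)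
      (fun κ hκ => hh.H_nonpos hanti (hsub hκ))
      (fun κ hκ => by linarith [hanti (hsub hκ) h1 hκ.2.le]) (by linarith) hs
  · intro hmono _ hb hb1
    have hη : 0 ≤ H h 1 := hh.H_nonneg hmono h1
    have hb0 : 0 < b := lt_of_lt_of_le (div_pos (by linarith) hden) hb
    have hH : ∀ κ ∈ Ioo (0 : ℝ) 1, 0 ≤ H h κ := fun κ hκ => hh.H_nonneg hmono (hsub hκ)
    have w := hh.isRegularWeight_of_monotoneOn hmono hc hb0 hb1 hfin'
    -- As in the antitone case, now with `η = H h 1`, the supremum of `H`.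
    rw [div_le_iff₀ hden] at hb
    obtain ⟨hwell, hmm⟩ := w.bayes_isMinimax fun s hs =>
      w.tiltedMoment_ineq_of_nonneg hH hη (fun κ hκ => hmono (hsub hκ) h1 hκ.2.le)
        (by linarith) hs
    have hnm : ¬ MonotoneOn (shrinkage p a b h) (Ioi 0) := fun hm => by
      refine w.not_monotoneOn_momentRatio hH hh.tendsto_H fun x hx y hy hxy => ?_
      simp only [momentRatio_eq_half_shrinkage]
      have := hm (mem_Ioi.2 (mul_pos two_pos hx)) (mem_Ioi.2 (mul_pos two_pos hy))
        (mul_le_mul_of_nonneg_left hxy zero_le_two)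
      linarith
    refine ⟨hwell, hmm, fun y hy => w.bayesEstimator_eq hy, hnm, fun hm => ?_, fun hB => hnm hB.1⟩
    refine not_antitoneOn_momentRatio w.integrableOn w.betaWeight_pos fun x hx y hy hxy => ?_
    simp only [momentRatio_eq_half_shrinkage]
    have := hm (mem_Ioi.2 (mul_pos two_pos hx)) (mem_Ioi.2 (mul_pos two_pos hy))
      (mul_le_mul_of_nonneg_left hxy zero_le_two)
    linarith
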